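/- Let $n\ge 1$. For an origin-symmetric convex body $K\subset\mathbb R^n$ (a compact convex set with non-empty interior and $K=-K$) let $\rho_K(u)=\sup\{\lambda\ge 0:\lambda u\in K\}$ be its radial function, let $du$ denote the surface measure on the unit sphere $\mathbb S^{n-1}$, and let $\omega_n$ be the volume of the Euclidean unit ball $B_2^n$. For $q\in\mathbb R$, the normalized $q$-th dual quermassintegral of $K$ is $$\bar V_q(K)=\Big(\frac1{n\omega_n}\int_{\mathbb S^{n-1}}\rho_K(u)^q\,du\Big)^{1/q}\quad(q\neq 0),\qquad \bar V_0(K)=\exp\Big(\frac1{n\omega_n}\int_{\mathbb S^{n-1}}\log\rho_K(u)\,du\Big).$$ Let $B_\infty^n=\{x\in\mathbb R^n:|x_i|\le 1 \text{ for all } i\}$ be the cube. Theorem (reverse isoperimetric inequality for dual quermassintegrals). Let $K\subset\mathbb R^n$ be an origin-symmetric convex body in John's position, i.e. $B_2^n$ is the ellipsoid of largest volume contained in $K$. Then $$\bar V_q(K)\le \bar V_q(B_\infty^n)\qquad\text{for every } q\in(-\infty,n],$$ and for each such $q$ equality holds if and only if $K$ is a rotation of $B_\infty^n$ (the image of $B_\infty^n$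 under an element of $SO(n)$). Moreover $\bar V_n(K)=(\mathrm{Vol}(K)/\omega_n)^{1/n}$, so that the case $q=n$ is Ball's volume ratio inequality $\mathrm{Vol}(K)/\omega_n\le \mathrm{Vol}(B_\infty^n)/\omega_n$. -/

import Mathlib

open MeasureTheory

noncomputable section

namespace DualQuermass

/-- An origin-symmetric convex body in `ℝⁿ`: a compact convex set with non-empty interior and
`K = -K` (so the origin is automatically an interior point). -/
structure IsSymmConvexBody {n : ℕ} (K : Set (EuclideanSpace ℝ (Fin n))) : Prop where
  convex : Convex ℝ K
  isCompact : IsCompact K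
  interior_nonempty : (interior K).Nonempty
  neg_mem : ∀ x ∈ K, -x ∈ K

/-- The Euclidean unit ball `B_2^n`. -/
def unitBall (n : ℕ) : Set (EuclideanSpace ℝ (Fin n)) := Metric.closedBall 0 1

/-- The cube `B_∞^n`. -/
def cube (n : ℕ) : Set (EuclideanSpace ℝ (Fin n)) := {x | ∀ i, |x i| ≤ 1}

/-- `ω_n`, the volume of the Euclidean unit ball. -/
def omega (n : ℕ) : ℝ := volume.real (unitBall n)

/-- Ellipsoids, with arbitrary centre: images of the unit ball under invertible affine maps. -/
def IsEllipsoid {n : ℕ} (E : Set (EuclideanSpace ℝ (Fin n))) : Prop :=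
  ∃ (T : EuclideanSpace ℝ (Fin n) ≃ₗ[ℝ] EuclideanSpace ℝ (Fin n))
    (c : EuclideanSpace ℝ (Fin n)), E = (fun x => T x + c) '' unitBall n

/-- John's position: `B_2^n` is contained in `K` and has the largest volume among all ellipsoids
contained in `K`. -/
def InJohnPosition {n : ℕ} (K : Set (EuclideanSpace ℝ (Fin n))) : Prop :=
  unitBall n ⊆ K ∧ ∀ E, IsEllipsoid E → E ⊆ K → volume E ≤ volume (unitBall n)

/-- The radial function `ρ_K(x) = sup {t ≥ 0 : t x ∈ K}`. -/
def radialFun {n : ℕ} (K : Set (EuclideanSpace ℝ (Fin n))) (x : EuclideanSpace ℝ (Fin n)) : ℝ :=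
  sSup {t : ℝ | 0 ≤ t ∧ t • x ∈ K}

/-- The surface measure on the unit sphere `S^{n-1}`, of total mass `n ω_n`. -/
def sphereMeasure (n : ℕ) : Measure (Metric.sphere (0 : EuclideanSpace ℝ (Fin n)) 1) :=
  (volume : Measure (EuclideanSpace ℝ (Fin n))).toSphere

/-- The `q`-th dual quermassintegral `(1/n) ∫_{S^{n-1}} ρ_K(u)^q du`. -/
def dualQuermass {n : ℕ} (q : ℝ) (K : Set (EuclideanSpace ℝ (Fin n))) : ℝ :=
  (1 / (n : ℝ)) * ∫ u, radialFun K (u : EuclideanSpace ℝ (Fin n)) ^ q ∂(sphereMeasure n)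

/-- The dual entropy `∫_{S^{n-1}} log ρ_K(u) du`. -/
def dualEntropy {n : ℕ} (K : Set (EuclideanSpace ℝ (Fin n))) : ℝ :=
  ∫ u, Real.log (radialFun K (u : EuclideanSpace ℝ (Fin n))) ∂(sphereMeasure n)

/-- The normalized `q`-th dual quermassintegral, defined through the dual entropy for `q = 0`. -/
def normDualQuermass {n : ℕ} (q : ℝ) (K : Set (EuclideanSpace ℝ (Fin n))) : ℝ :=
  if q = 0 then Real.exp (1 / (n * omega n) * dualEntropy K)
  else (dualQuermass q K / omega n) ^ (1 / q)

/-- `K` is the image of `L` under a rotation, i.e. an element of `SO(n)`. -/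
def IsRotationOf {n : ℕ} (K L : Set (EuclideanSpace ℝ (Fin n))) : Prop :=
  ∃ U : EuclideanSpace ℝ (Fin n) ≃ₗᵢ[ℝ] EuclideanSpace ℝ (Fin n),
    LinearMap.det (U.toLinearEquiv : EuclideanSpace ℝ (Fin n) →ₗ[ℝ] EuclideanSpace ℝ (Fin n)) = 1 ∧
      K = U '' L

end DualQuermass

end

namespace DualQuermass

open Set Filter Topology
open scoped RealInnerProductSpace

/-! The whole range `q ≤ n` follows from one family of inequalities: for every `s`, the mass of `exp
(-s‖x‖²)` on `K` is at most its mass on the cube, which is `slabMass s ^ n`.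

John's theorem (`exists_johnFrame`) writes the identity as `∑ cᵢ uᵢ ⊗ uᵢ` and encloses `K` in the
slabs `|⟪uᵢ, x⟫| ≤ 1`. Following Barthe, let `T` transport `exp (-s x²)` on `(-1, 1)`, suitably
normalized, to the Gaussian density. The map `y ↦ ∑ cᵢ T⟪uᵢ, y⟫ uᵢ` is injective on the open
polytope, and Ball's determinant inequality bounds its Jacobian below. Changing variables in the
Gaussian integral yields `lintegral_openSlabs_le`.

For `q < n`, `‖x‖ ^ (q - n)` is a positive mixture of the functions `exp (-s‖x‖²)` with `s > 0`. It
need not be integrable at the origin, so the unit ball, common to `K` and the cube, is removed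
first. In polar coordinates the resulting `shellMass` is the spherical integral of `(ρ ^ q - 1) /
q`, or of `log ρ` when `q = 0`. The normalized dual quermassintegral is a strictly increasing
function of this number for every sign of `q`.

Equality splits on the volume. If `volume K < 2 ^ n`, the Gaussian inequality is strict for small
`s`, hence the result is strict for all `q ≤ n`. If `volume K ≥ 2 ^ n`, the transport estimate at `s
= 0` has no defect. The derivative of the transport then has every `uᵢ` as an eigenvector, which
forces the frame vectors to be pairwise parallel or orthogonal, and `K` is a rotated cube. -/

/-! ### Compactness of convex hulls -/

theorem sum_eq_sum_of_embedding {ι κ G : Type*} [Fintype ι] [Fintype κ] [AddCommMonoid G]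
    (e : ι ↪ κ) {f : κ → G} {g : ι → G} (h1 : ∀ i, f (e i) = g i)
    (h2 : ∀ j, j ∉ range e → f j = 0) : ∑ j, f j = ∑ i, g i := by
  rw [← Finset.sum_subset (Finset.subset_univ (Finset.univ.map e))
    (fun j _ hj => h2 j (by simpa using hj)), Finset.sum_map]
  exact Finset.sum_congr rfl fun i _ => h1 i

/-- In finite dimension the convex hull of a compact set is compact. -/
theorem isCompact_convexHull {F : Type*} [NormedAddCommGroup F] [NormedSpace ℝ F]
    [FiniteDimensional ℝ F] {s : Set F} (hs : IsCompact s) : IsCompact (convexHull ℝ s) := by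
  classical
  rcases s.eq_empty_or_nonempty with rfl | ⟨x₀, hx₀⟩
  · simp
  -- Carathéodory: `d` points always suffice, so the hull is the continuous image of a compact set
  -- of weights and points.
  set d := Module.finrank ℝ F + 1
  let Φ : (Fin d → ℝ) × (Fin d → F) → F := fun p => ∑ i, p.1 i • p.2 i
  have hΦ : Continuous Φ := by fun_prop
  have hcomp : IsCompact (stdSimplex ℝ (Fin d) ×ˢ (Set.univ.pi fun _ : Fin d => s)) :=
    (isCompact_stdSimplex ℝ (Fin d)).prod (isCompact_univ_pi fun _ => hs)
  convert hcomp.image hΦ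
  apply Subset.antisymm
  · intro x hx
    obtain ⟨ι, _, z, w, hz, hai, hw, hw1, hx⟩ := eq_pos_convex_span_of_mem_convexHull hx
    have hcard : Fintype.card ι ≤ Fintype.card (Fin d) := by
      simp only [Fintype.card_fin, d]
      exact hai.card_le_finrank_succ.trans (by gcongr; exact Submodule.finrank_le _)
    obtain ⟨e⟩ := Function.Embedding.nonempty_of_card_le hcard
    -- Shorter combinations are padded with weight `0` at the dummy point `x₀`.
    refine ⟨(Function.extend e w 0, Function.extend e z fun _ => x₀), ⟨⟨?_, ?_⟩, ?_⟩, ?_⟩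
    · intro j
      by_cases hj : ∃ i, e i = j
      · obtain ⟨i, rfl⟩ := hj
        simpa [e.injective.extend_apply] using (hw i).le
      · simp [Function.extend_apply' _ _ _ hj]
    · rw [← hw1]
      exact sum_eq_sum_of_embedding e (fun i => e.injective.extend_apply _ _ _)
        (fun j hj => by simp [Function.extend_apply' _ _ _ hj])
    · intro j _
      by_cases hj : ∃ i, e i = j
      · obtain ⟨i, rfl⟩ := hj
        simpa [e.injective.extend_apply] using hz (mem_range_self i)
      · simpa [Function.extend_apply' _ _ _ hj] using hx₀
    · rw [← hx]
      exact sum_eq_sum_of_embedding e (fun i => by simp [e.injective.extend_apply])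
        (fun j hj => by simp [Function.extend_apply' w _ _ hj])
  · rintro _ ⟨⟨w, z⟩, ⟨⟨hw0, hw1⟩, hz⟩, rfl⟩
    exact (convex_convexHull ℝ s).sum_mem (fun i _ => hw0 i) hw1
      (fun i _ => subset_convexHull ℝ s (hz i (mem_univ i)))

/-! ### John's theorem -/

/-- A decomposition of the identity `∑ cᵢ uᵢ ⊗ uᵢ = Id` with positive weights and unit vectors. -/
structure IsJohnFrame {n : ℕ} {ι : Type} [Fintype ι] (c : ι → ℝ)
    (u : ι → EuclideanSpace ℝ (Fin n)) : Prop where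
  pos : ∀ i, 0 < c i
  norm : ∀ i, ‖u i‖ = 1
  decomp : ∀ x, ∑ i, (c i * ⟪u i, x⟫) • u i = x

/-- The vectors of the polar body of `K` of norm one. -/
def contactSet {n : ℕ} (K : Set (EuclideanSpace ℝ (Fin n))) : Set (EuclideanSpace ℝ (Fin n)) :=
  {y | ‖y‖ = 1 ∧ ∀ x ∈ K, ⟪y, x⟫ ≤ 1}

theorem isCompact_contactSet {n : ℕ} (K : Set (EuclideanSpace ℝ (Fin n))) :
    IsCompact (contactSet K) := by
  refine (isCompact_sphere (0 : EuclideanSpace ℝ (Fin n)) 1).of_isClosed_subset ?_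
    (fun y hy => by simpa using hy.1)
  have : contactSet K = {y | ‖y‖ = 1} ∩ ⋂ x ∈ K, {y | ⟪y, x⟫ ≤ 1} := by
    ext y; simp [contactSet]
  rw [this]
  exact (isClosed_eq (by fun_prop) (by fun_prop)).inter
    (isClosed_biInter fun x _ => isClosed_le (by fun_prop) (by fun_prop))

/-- If `M` is negative on the contact directions, small perturbations `(1 + δ M) B` of the ball
stay in `K`. -/
theorem exists_perturbed_ball_subset {n : ℕ} {K : Set (EuclideanSpace ℝ (Fin n))}
    (hconv : Convex ℝ K) (hcl : IsClosed K) (hB : unitBall n ⊆ K)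
    (M : EuclideanSpace ℝ (Fin n) →L[ℝ] EuclideanSpace ℝ (Fin n))
    (hM : ∀ y ∈ contactSet K, ⟪M y, y⟫ < 0) :
    ∃ δ₀ : ℝ, 0 < δ₀ ∧ ∀ δ, 0 < δ → δ < δ₀ → ∀ x ∈ unitBall n, x + δ • M x ∈ K := by
  have h0 : (0 : EuclideanSpace ℝ (Fin n)) ∈ K := hB (by simp [unitBall])
  set P : Set (EuclideanSpace ℝ (Fin n)) := {y | ∀ a ∈ K, ⟪y, a⟫ ≤ 1} with hP
  have hP1 : ∀ y ∈ P, ‖y‖ ≤ 1 := by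
    intro y hy
    rcases eq_or_ne y 0 with rfl | hy0
    · simp
    have h1 := hy (‖y‖⁻¹ • y) (hB (by simp [unitBall, norm_smul, hy0]))
    rw [real_inner_smul_right, real_inner_self_eq_norm_sq] at h1
    have : 0 < ‖y‖ := norm_pos_iff.2 hy0
    field_simp at h1
    exact h1
  have hPcomp : IsCompact P := by
    refine (isCompact_closedBall (0 : EuclideanSpace ℝ (Fin n)) 1).of_isClosed_subset ?_
      (fun y hy => by simpa using hP1 y hy)
    have : P = ⋂ x ∈ K, {y | ⟪y, x⟫ ≤ 1} := by ext y; simp [hP]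
    rw [this]
    exact isClosed_biInter fun x _ => isClosed_le (by fun_prop) (by fun_prop)
  -- Each `y` in the polar body `P` is either shorter than one or a contact direction, where `M` is
  -- negative. Compactness makes this alternative uniform.
  set g : EuclideanSpace ℝ (Fin n) → ℝ := fun y => max (1 - ‖y‖ ^ 2) (-⟪M y, y⟫) with hg
  have hgc : Continuous g := by fun_prop
  obtain ⟨y₀, hy₀, hmin⟩ := hPcomp.exists_isMinOn ⟨0, by simp [hP]⟩ hgc.continuousOn
  have hε : 0 < g y₀ := by
    by_cases h : ‖y₀‖ = 1
    · exact lt_max_of_lt_right (by have := hM y₀ ⟨h, hy₀⟩; linarith)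
    · have h1 := lt_of_le_of_ne (hP1 y₀ hy₀) h
      exact lt_max_of_lt_left (by nlinarith [norm_nonneg y₀])
  set ε : ℝ := g y₀
  set A := ContinuousLinearMap.adjoint M
  set m := ‖A‖
  have hm : 0 ≤ m := norm_nonneg _
  -- This keeps `‖y + δ • A y‖ ^ 2` at most one on `P`: where `1 - ‖y‖ ^ 2 ≥ ε` it needs `2δm + δm²
  -- < ε`, and where `-⟪M y, y⟫ ≥ ε` it needs `δm² ≤ ε`.
  refine ⟨min 1 (ε / (2 * m + m ^ 2 + 1)), lt_min one_pos (by positivity), ?_⟩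
  intro δ hδ hδ₀ x hx
  have hδ1 : δ < 1 := hδ₀.trans_le (min_le_left _ _)
  have hδ2 : δ * (2 * m + m ^ 2 + 1) < ε := by
    rw [← lt_div_iff₀ (by positivity)]; exact hδ₀.trans_le (min_le_right _ _)
  by_contra hz
  obtain ⟨f, v, hfK, hfz⟩ := geometric_hahn_banach_closed_point hconv hcl hz
  have hv : 0 < v := by simpa using hfK 0 h0
  set y : EuclideanSpace ℝ (Fin n) := v⁻¹ • (InnerProductSpace.toDual ℝ _).symm f with hy
  have hyf : ∀ a, ⟪y, a⟫ = v⁻¹ * f a := by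
    intro a
    rw [hy, real_inner_smul_left, InnerProductSpace.toDual_symm_apply]
  clear_value y
  have hyP : y ∈ P := by
    intro a ha
    rw [hyf, inv_mul_le_one₀ hv]
    exact (hfK a ha).le
  have hyz : 1 < ⟪y, x + δ • M x⟫ := by
    rw [hyf, ← div_eq_inv_mul, one_lt_div hv]
    exact hfz
  have hx1 : ‖x‖ ≤ 1 := by simpa [unitBall] using hx
  have e1 : ⟪y, x + δ • M x⟫ = ⟪y + δ • A y, x⟫ := by
    rw [inner_add_right, inner_add_left, real_inner_smul_right, real_inner_smul_left,
      ContinuousLinearMap.adjoint_inner_left]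
  have e2 : ⟪y + δ • A y, x⟫ ≤ ‖y + δ • A y‖ :=
    (real_inner_le_norm _ _).trans (mul_le_of_le_one_right (norm_nonneg _) hx1)
  have e3 : ‖y + δ • A y‖ ^ 2 = ‖y‖ ^ 2 + 2 * δ * ⟪M y, y⟫ + δ ^ 2 * ‖A y‖ ^ 2 := by
    rw [norm_add_sq_real, real_inner_smul_right, ContinuousLinearMap.adjoint_inner_right,
      norm_smul, mul_pow, Real.norm_eq_abs, sq_abs]
    ring
  have hy1 := hP1 y hyP
  have hAy : ‖A y‖ ≤ m := (A.le_opNorm y).trans (mul_le_of_le_one_right hm hy1)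
  have hAy2 : ‖A y‖ ^ 2 ≤ m ^ 2 := by gcongr
  have hMy : ⟪M y, y⟫ ≤ m := by
    rw [← ContinuousLinearMap.adjoint_inner_right]
    exact (real_inner_le_norm _ _).trans
      ((mul_le_of_le_one_left (norm_nonneg _) hy1).trans hAy)
  have hlt : 1 < ‖y + δ • A y‖ ^ 2 := by
    have : 1 < ‖y + δ • A y‖ := by linarith
    nlinarith
  have hgy : ε ≤ g y := hmin hyP
  rw [e3] at hlt
  have q1 : δ ^ 2 * ‖A y‖ ^ 2 ≤ δ ^ 2 * m ^ 2 := by gcongr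
  rcases le_max_iff.1 hgy with h | h
  · have : δ ^ 2 * m ^ 2 ≤ δ * m ^ 2 := by
      have : δ ^ 2 ≤ δ := by nlinarith
      gcongr
    have : δ * ⟪M y, y⟫ ≤ δ * m := by gcongr
    nlinarith
  · have h2 : ‖y‖ ^ 2 ≤ 1 := by nlinarith [norm_nonneg y]
    have : δ * ε ≤ δ * -⟪M y, y⟫ := by gcongr
    have : δ * (δ * m ^ 2) ≤ δ * ε := by
      gcongr; nlinarith
    nlinarith

/-- A perturbation of the identity of positive trace eventually increases volume. -/
theorem exists_one_lt_det {n : ℕ} (M : Matrix (Fin n) (Fin n) ℝ) (hM : 0 < M.trace)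
    {δ₀ : ℝ} (hδ₀ : 0 < δ₀) : ∃ δ, 0 < δ ∧ δ < δ₀ ∧ 1 < (1 + δ • M).det := by
  -- `p` is the remainder in `det (1 + δM) = 1 + δ tr M + δ² p(δ)`.
  set p := (Matrix.det (1 + (Polynomial.X : Polynomial ℝ) • M.map Polynomial.C)).divX.divX
  have hc : Continuous fun δ : ℝ => M.trace + p.eval δ * δ := by
    have := p.continuous
    fun_prop
  have h1 : ∀ᶠ δ in 𝓝 (0 : ℝ), 0 < M.trace + p.eval δ * δ :=
    (hc.tendsto 0).eventually (lt_mem_nhds (by simpa using hM))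
  have h2 : ∀ᶠ δ in 𝓝[>] (0 : ℝ), 0 < M.trace + p.eval δ * δ := h1.filter_mono nhdsWithin_le_nhds
  obtain ⟨δ, h, hδ⟩ := (h2.and (Ioo_mem_nhdsGT hδ₀)).exists
  refine ⟨δ, hδ.1, hδ.2, ?_⟩
  rw [Matrix.det_one_add_smul]
  have := mul_pos hδ.1 h
  nlinarith

/-- A separation argument among matrices: if `Id / n` is not a convex combination of tensors `y ⊗ y`
of contact directions, a separating functional gives a matrix `M` of positive trace whose quadratic
form is negative on all contact directions. Then for some small `δ` the ellipsoid `(1 + δM) B` lies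
in `K` and has larger volume than the ball. -/
theorem exists_johnFrame {n : ℕ} (hn : 1 ≤ n) {K : Set (EuclideanSpace ℝ (Fin n))}
    (hK : IsSymmConvexBody K) (hJ : InJohnPosition K) :
    ∃ (ι : Type) (_ : Fintype ι) (c : ι → ℝ) (u : ι → EuclideanSpace ℝ (Fin n)),
      IsJohnFrame c u ∧ ∀ i, ∀ x ∈ K, |⟪u i, x⟫| ≤ 1 := by
  classical
  have hn0 : (n : ℝ) ≠ 0 := by positivity
  let tensor : EuclideanSpace ℝ (Fin n) → (Fin n × Fin n → ℝ) := fun x p => x p.1 * x p.2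
  have htc : Continuous tensor := by
    unfold tensor; fun_prop
  -- Each `y ⊗ y` has trace one, hence the factor `1 / n`; it is undone by the weights `n * w i`.
  set target : Fin n × Fin n → ℝ := fun p => if p.1 = p.2 then 1 / (n : ℝ) else 0 with htarget
  by_cases hmem : target ∈ convexHull ℝ (tensor '' contactSet K)
  · obtain ⟨ι, _, z, w, hz, -, hw, hw1, hx⟩ := eq_pos_convex_span_of_mem_convexHull hmem
    have hz' : ∀ i, ∃ y ∈ contactSet K, tensor y = z i := fun i => hz (mem_range_self i)
    choose u hu hut using hz'
    refine ⟨ι, inferInstance, fun i => n * w i, u, ⟨fun i => by have := hw i; positivity,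
      fun i => (hu i).1, fun x => ?_⟩, fun i x hxK => ?_⟩
    · ext k
      have hk : ∀ l, ∑ i, w i * (u i l * u i k) = if l = k then 1 / (n : ℝ) else 0 := by
        intro l
        have := congrFun hx (l, k)
        simpa [← hut, tensor, htarget] using this
      have : (∑ i, ((n * w i) * ⟪u i, x⟫) • u i) k
          = ∑ l, (n * x l) * ∑ i, w i * (u i l * u i k) := by
        simp only [PiLp.inner_apply, WithLp.ofLp_sum, WithLp.ofLp_smul, Finset.sum_apply,
          Pi.smul_apply, smul_eq_mul, Finset.mul_sum, Finset.sum_mul]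
        rw [Finset.sum_comm]
        refine Finset.sum_congr rfl fun l _ => Finset.sum_congr rfl fun i _ => ?_
        simp
        ring
      rw [this]
      simp only [hk, mul_ite, mul_zero, Finset.sum_ite_eq', Finset.mem_univ, if_true]
      field_simp
    · rw [abs_le]
      have h1 := (hu i).2 x hxK
      have h2 := (hu i).2 (-x) (hK.neg_mem x hxK)
      rw [inner_neg_right] at h2
      constructor <;> linarith
  · exfalso
    obtain ⟨f, v, hfS, hfv⟩ := geometric_hahn_banach_closed_point (convex_convexHull ℝ _)
      (isCompact_convexHull ((isCompact_contactSet K).image htc)).isClosed hmem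
    set F : Fin n × Fin n → ℝ := fun p => f (Pi.single p 1)
    have hfF : ∀ A, f A = ∑ p, A p * F p := by
      intro A
      have := LinearMap.pi_apply_eq_sum_univ f.toLinearMap A
      simp only [ContinuousLinearMap.coe_coe, smul_eq_mul] at this
      rw [this]
      refine Finset.sum_congr rfl fun p _ => ?_
      congr 2
      ext q
      simp [Pi.single_apply, eq_comm]
    -- Subtracting `v` times the identity absorbs the separation threshold: `tr M = n (f target -
    -- v)`, and `⟪M y, y⟫ = f (y ⊗ y) - v` for unit `y`.
    set M : Matrix (Fin n) (Fin n) ℝ := fun i j => F (i, j) - if i = j then v else 0 with hM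
    set L : EuclideanSpace ℝ (Fin n) →ₗ[ℝ] EuclideanSpace ℝ (Fin n) := Matrix.toEuclideanLin M
    have htr : 0 < M.trace := by
      have h1 : M.trace = n * (f target - v) := by
        rw [hfF, Fintype.sum_prod_type]
        simp only [Matrix.trace, Matrix.diag, hM, htarget]
        simp [Finset.sum_sub_distrib, mul_sub, ← Finset.mul_sum]
        field_simp
      rw [h1]
      exact mul_pos (by positivity) (by linarith)
    have hneg : ∀ y ∈ contactSet K, ⟪L y, y⟫ < 0 := by
      intro y hy
      have h1 := hfS _ (subset_convexHull ℝ _ (mem_image_of_mem tensor hy))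
      have hy1 : ∑ i, y i * y i = 1 := by
        have := real_inner_self_eq_norm_sq y
        rw [hy.1, PiLp.inner_apply] at this
        simpa [← sq] using this
      have h2 : ⟪L y, y⟫ = f (tensor y) - v := by
        have hL : ∀ i, L y i = ∑ j, F (i, j) * y j - v * y i := by
          intro i
          change ∑ j, M i j * y j = _
          simp [hM, sub_mul, Finset.sum_sub_distrib]
        rw [hfF, Fintype.sum_prod_type, PiLp.inner_apply]
        simp only [hL, RCLike.inner_apply, conj_trivial, mul_sub, Finset.sum_sub_distrib]
        congr 1
        · refine Finset.sum_congr rfl fun i _ => ?_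
          rw [Finset.mul_sum]
          refine Finset.sum_congr rfl fun j _ => ?_
          simp only [tensor]
          ring
        · calc ∑ i, y i * (v * y i) = v * ∑ i, y i * y i := by
                rw [Finset.mul_sum]; exact Finset.sum_congr rfl fun i _ => by ring
            _ = v := by rw [hy1, mul_one]
      linarith
    obtain ⟨δ₀, hδ₀, hsub⟩ := exists_perturbed_ball_subset hK.convex hK.isCompact.isClosed hJ.1
      (LinearMap.toContinuousLinearMap L) hneg
    obtain ⟨δ, hδ, hδ', hdet⟩ := exists_one_lt_det M htr hδ₀
    set T : EuclideanSpace ℝ (Fin n) →ₗ[ℝ] EuclideanSpace ℝ (Fin n) := LinearMap.id + δ • L with hT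
    have hTdet : LinearMap.det T = (1 + δ • M).det := by
      have : T = Matrix.toEuclideanLin (1 + δ • M) := by
        simp only [hT, L, map_add, map_smul]
        congr 1
        ext x i
        simp [Matrix.toEuclideanLin]
      rw [this]
      rw [Matrix.toEuclideanLin, Matrix.toLpLin_eq_toLin, LinearMap.det_toLin]
    have hne : LinearMap.det T ≠ 0 := by rw [hTdet]; positivity
    let Te := LinearMap.equivOfDetNeZero T hne
    have hvol := hJ.2 (T '' unitBall n)
      ⟨Te, 0, by simp [Te, LinearMap.equivOfDetNeZero]⟩
      (by rintro _ ⟨x, hx, rfl⟩; exact hsub δ hδ hδ' x hx)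
    rw [Measure.addHaar_image_linearMap, hTdet] at hvol
    have hpos : volume (unitBall n) ≠ 0 := (Metric.measure_closedBall_pos _ _ one_pos).ne'
    have hfin : volume (unitBall n) ≠ ⊤ := (isCompact_closedBall _ _).measure_lt_top.ne
    have h1 : (1 : ENNReal) < ENNReal.ofReal |(1 + δ • M).det| := by
      rw [ENNReal.one_lt_ofReal]; exact hdet.trans_le (le_abs_self _)
    have := ENNReal.mul_lt_mul_left hpos hfin h1
    simp only [one_mul] at this
    exact absurd hvol (not_le.2 (by simpa [mul_comm] using this))

/-! ### Frame identities and Ball's determinant inequality -/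

namespace IsJohnFrame

variable {n : ℕ} {ι : Type} [Fintype ι] {c : ι → ℝ} {u : ι → EuclideanSpace ℝ (Fin n)}

theorem sum_mul_inner (h : IsJohnFrame c u) (x y : EuclideanSpace ℝ (Fin n)) :
    ∑ i, c i * (⟪u i, x⟫ * ⟪u i, y⟫) = ⟪x, y⟫ := by
  conv_rhs => rw [← h.decomp x]
  rw [sum_inner]
  exact Finset.sum_congr rfl fun i _ => by rw [real_inner_smul_left, mul_assoc]

theorem sum_mul_inner_sq (h : IsJohnFrame c u) (x : EuclideanSpace ℝ (Fin n)) :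
    ∑ i, c i * ⟪u i, x⟫ ^ 2 = ‖x‖ ^ 2 := by
  rw [← real_inner_self_eq_norm_sq, ← h.sum_mul_inner]
  exact Finset.sum_congr rfl fun i _ => by rw [sq]

theorem sum_weights (h : IsJohnFrame c u) : ∑ i, c i = n := by
  set b := EuclideanSpace.basisFun (Fin n) ℝ
  have h1 : ∑ j, ∑ i, c i * ⟪u i, b j⟫ ^ 2 = n := by
    simp only [h.sum_mul_inner_sq, b.norm_eq_one]
    simp
  rw [Finset.sum_comm] at h1
  rw [← h1]
  refine Finset.sum_congr rfl fun i _ => ?_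
  rw [← Finset.mul_sum, b.sum_sq_inner_left, h.norm]
  simp

theorem eq_zero_of_inner_eq_zero (h : IsJohnFrame c u) {x : EuclideanSpace ℝ (Fin n)}
    (hx : ∀ i, ⟪u i, x⟫ = 0) : x = 0 := by
  rw [← h.decomp x]
  simp [hx]

/-- Coefficients have at least the energy of the vector they synthesize; the defect is explicit. -/
theorem sum_mul_sub_inner_sq (h : IsJohnFrame c u) (t : ι → ℝ) :
    ∑ i, c i * (t i - ⟪u i, ∑ j, (c j * t j) • u j⟫) ^ 2 =
      ∑ i, c i * t i ^ 2 - ‖∑ j, (c j * t j) • u j‖ ^ 2 := by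
  set z := ∑ j, (c j * t j) • u j with hz
  have h1 := h.sum_mul_inner_sq z
  have h2 : ∑ i, c i * t i * ⟪u i, z⟫ = ‖z‖ ^ 2 := by
    rw [← real_inner_self_eq_norm_sq]
    conv_rhs => rw [hz, sum_inner]
    exact Finset.sum_congr rfl fun i _ => by rw [real_inner_smul_left]
  calc ∑ i, c i * (t i - ⟪u i, z⟫) ^ 2
      = ∑ i, c i * t i ^ 2 - 2 * ∑ i, c i * t i * ⟪u i, z⟫ + ∑ i, c i * ⟪u i, z⟫ ^ 2 := by
        rw [Finset.mul_sum, ← Finset.sum_sub_distrib, ← Finset.sum_add_distrib]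
        exact Finset.sum_congr rfl fun i _ => by ring
    _ = _ := by rw [h1, h2]; ring

end IsJohnFrame

/-- The operator `∑ cᵢ tᵢ uᵢ ⊗ uᵢ`. -/
noncomputable def frameOp {n : ℕ} {ι : Type} [Fintype ι] (c : ι → ℝ)
    (u : ι → EuclideanSpace ℝ (Fin n)) (t : ι → ℝ) :
    EuclideanSpace ℝ (Fin n) →L[ℝ] EuclideanSpace ℝ (Fin n) :=
  ∑ i, (c i * t i) • (innerSL ℝ (u i)).smulRight (u i)

section

variable {n : ℕ} {ι : Type} [Fintype ι] {c : ι → ℝ} {u : ι → EuclideanSpace ℝ (Fin n)}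

theorem frameOp_apply (t : ι → ℝ) (x : EuclideanSpace ℝ (Fin n)) :
    frameOp c u t x = ∑ i, (c i * t i * ⟪u i, x⟫) • u i := by
  simp [frameOp, smul_smul]

theorem inner_frameOp (t : ι → ℝ) (x y : EuclideanSpace ℝ (Fin n)) :
    ⟪frameOp c u t x, y⟫ = ∑ i, c i * t i * (⟪u i, x⟫ * ⟪u i, y⟫) := by
  rw [frameOp_apply, sum_inner]
  exact Finset.sum_congr rfl fun i _ => by rw [real_inner_smul_left]; ring

theorem isSymmetric_frameOp (t : ι → ℝ) :
    (frameOp c u t : EuclideanSpace ℝ (Fin n) →ₗ[ℝ] EuclideanSpace ℝ (Fin n)).IsSymmetric := by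
  intro x y
  change ⟪frameOp c u t x, y⟫ = ⟪x, frameOp c u t y⟫
  rw [real_inner_comm (frameOp c u t y) x,
    inner_frameOp, inner_frameOp]
  exact Finset.sum_congr rfl fun i _ => by ring

/-- Ball's determinant inequality. -/
theorem IsJohnFrame.prod_rpow_le_det (h : IsJohnFrame c u) {t : ι → ℝ} (ht : ∀ i, 0 < t i) :
    ∏ i, t i ^ c i ≤ (frameOp c u t).det := by
  have hn : Module.finrank ℝ (EuclideanSpace ℝ (Fin n)) = n := by simp
  have hs := isSymmetric_frameOp (c := c) (u := u) t
  set b := hs.eigenvectorBasis hn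
  set ev := hs.eigenvalues hn
  have hdet : (frameOp c u t).det = ∏ j, ev j := by
    rw [ContinuousLinearMap.det]
    exact hs.det_eq_prod_eigenvalues hn
  have hev : ∀ j, ev j = ∑ i, (c i * ⟪u i, b j⟫ ^ 2) * t i := by
    intro j
    have h1 : frameOp c u t (b j) = ev j • b j := hs.apply_eigenvectorBasis hn j
    have h2 : ⟪frameOp c u t (b j), b j⟫ = ev j := by
      rw [h1, real_inner_smul_left, real_inner_self_eq_norm_sq, b.norm_eq_one]; simp
    rw [← h2, inner_frameOp]
    exact Finset.sum_congr rfl fun i _ => by ring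
  have hamgm : ∀ j, ∏ i, t i ^ (c i * ⟪u i, b j⟫ ^ 2) ≤ ev j := by
    intro j
    rw [hev]
    refine Real.geom_mean_le_arith_mean_weighted _ _ _
      (fun i _ => mul_nonneg (h.pos i).le (sq_nonneg _)) ?_ fun i _ => (ht i).le
    rw [h.sum_mul_inner_sq, b.norm_eq_one, one_pow]
  rw [hdet]
  -- The array `c i * ⟪u i, b j⟫ ^ 2` sums to `c i` over `j`, since `u i` is a unit vector, and to
  -- one over `i`, by the frame identity. Thus weighted AM-GM applies to each eigenvalue.
  calc ∏ i, t i ^ c i = ∏ i, ∏ j, t i ^ (c i * ⟪u i, b j⟫ ^ 2) := by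
        refine Finset.prod_congr rfl fun i _ => ?_
        rw [← Real.rpow_sum_of_pos (ht i), ← Finset.mul_sum, b.sum_sq_inner_left, h.norm]
        simp
    _ = ∏ j, ∏ i, t i ^ (c i * ⟪u i, b j⟫ ^ 2) := Finset.prod_comm
    _ ≤ ∏ j, ev j := Finset.prod_le_prod
        (fun j _ => Finset.prod_nonneg fun i _ => Real.rpow_nonneg (ht i).le _)
        (fun j _ => hamgm j)

end

/-! ### The one-dimensional transport -/

/-- `∫₀ˣ exp (-s t²) dt`. -/
noncomputable def gaussPrim (s x : ℝ) : ℝ := ∫ t in (0 : ℝ)..x, Real.exp (-s * t ^ 2)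

/-- `∫₋₁¹ exp (-s t²) dt`. -/
noncomputable def slabMass (s : ℝ) : ℝ := ∫ t in (-1 : ℝ)..1, Real.exp (-s * t ^ 2)

theorem hasStrictDerivAt_gaussPrim (s x : ℝ) :
    HasStrictDerivAt (gaussPrim s) (Real.exp (-s * x ^ 2)) x := by
  have hc : Continuous fun t : ℝ => Real.exp (-s * t ^ 2) := by fun_prop
  exact hc.integral_hasStrictDerivAt 0 x

theorem continuous_gaussPrim (s : ℝ) : Continuous (gaussPrim s) :=
  continuous_iff_continuousAt.2 fun x => (hasStrictDerivAt_gaussPrim s x).hasDerivAt.continuousAt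

theorem strictMono_gaussPrim (s : ℝ) : StrictMono (gaussPrim s) :=
  strictMono_of_deriv_pos fun x => by
    rw [(hasStrictDerivAt_gaussPrim s x).hasDerivAt.deriv]; positivity

@[simp] theorem gaussPrim_zero (s : ℝ) : gaussPrim s 0 = 0 := by simp [gaussPrim]

theorem gaussPrim_neg (s x : ℝ) : gaussPrim s (-x) = -gaussPrim s x := by
  have := intervalIntegral.integral_comp_neg (a := 0) (b := x)
    (fun t : ℝ => Real.exp (-s * t ^ 2))
  simp only [neg_sq, neg_zero] at this
  rw [gaussPrim, gaussPrim, this, intervalIntegral.integral_symm]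

theorem slabMass_eq (s : ℝ) : slabMass s = 2 * gaussPrim s 1 := by
  have hc : Continuous fun t : ℝ => Real.exp (-s * t ^ 2) := by fun_prop
  have h := intervalIntegral.integral_add_adjacent_intervals
    (hc.intervalIntegrable (μ := volume) (-1) 0) (hc.intervalIntegrable 0 1)
  rw [slabMass, ← h, intervalIntegral.integral_symm]
  change -gaussPrim s (-1) + gaussPrim s 1 = _
  rw [gaussPrim_neg]; ring

theorem slabMass_pos (s : ℝ) : 0 < slabMass s := by
  rw [slabMass_eq]
  have := strictMono_gaussPrim s one_pos
  rw [gaussPrim_zero] at this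
  positivity

theorem slabMass_zero : slabMass 0 = 2 := by
  norm_num [slabMass]

theorem mem_range_gaussPrim_one {v : ℝ} (hv : |v| < √Real.pi / 2) : v ∈ range (gaussPrim 1) := by
  have hlim : Tendsto (gaussPrim 1) atTop (𝓝 (√Real.pi / 2)) := by
    have := intervalIntegral_tendsto_integral_Ioi (μ := volume)
      (f := fun t : ℝ => Real.exp (-1 * t ^ 2)) 0
      ((integrable_exp_neg_mul_sq one_pos).integrableOn) tendsto_id
    rw [integral_gaussian_Ioi, div_one] at this
    exact this
  have key : ∀ w : ℝ, w < √Real.pi / 2 → ∃ x, w ≤ gaussPrim 1 x := fun w hw =>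
    ((hlim.eventually (lt_mem_nhds hw)).exists).imp fun _ h => h.le
  rw [abs_lt] at hv
  obtain ⟨x, hx⟩ := key v hv.2
  obtain ⟨y, hy⟩ := key (-v) (by linarith)
  exact mem_range_of_exists_le_of_exists_ge (continuous_gaussPrim 1)
    ⟨-y, by rw [gaussPrim_neg]; linarith⟩ ⟨x, hx⟩

/-- The monotone transport of the density `exp (-s x²)` on `(-1, 1)` to the Gaussian density. -/
theorem exists_gaussian_transport (s : ℝ) : ∃ T : ℝ → ℝ, T 0 = 0 ∧ ∀ x ∈ Ioo (-1 : ℝ) 1,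
    HasDerivAt T (√Real.pi / slabMass s * Real.exp (T x ^ 2) * Real.exp (-s * x ^ 2)) x := by
  have hopen : IsOpenMap (gaussPrim 1) :=
    isOpenMap_of_hasStrictDerivAt (hasStrictDerivAt_gaussPrim 1) fun x => (Real.exp_pos _).ne'
  have hemb : IsOpenEmbedding (gaussPrim 1) :=
    .of_continuous_injective_isOpenMap (continuous_gaussPrim 1)
      (strictMono_gaussPrim 1).injective hopen
  set e := hemb.toOpenPartialHomeomorph (gaussPrim 1)
  have hpi : 0 < √Real.pi := Real.sqrt_pos.2 Real.pi_pos
  set k := √Real.pi / slabMass s with hk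
  have hk0 : 0 < k := div_pos hpi (slabMass_pos s)
  -- The factor `k` matches total masses, so `k * gaussPrim s x` stays in the range of `gaussPrim 1`
  -- exactly while `|x| < 1`.
  refine ⟨fun x => e.symm (k * gaussPrim s x), ?_, fun x hx => ?_⟩
  · have := e.left_inv (x := 0) (mem_univ _)
    change e.symm (gaussPrim 1 0) = 0 at this
    simpa using this
  · have htarget : k * gaussPrim s x ∈ e.target := by
      rw [hemb.toOpenPartialHomeomorph_target]
      apply mem_range_gaussPrim_one
      have h1 : gaussPrim s x < gaussPrim s 1 := strictMono_gaussPrim s hx.2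
      have h2 : -gaussPrim s 1 < gaussPrim s x := by
        rw [← gaussPrim_neg]; exact strictMono_gaussPrim s hx.1
      have h3 : k * gaussPrim s 1 = √Real.pi / 2 := by
        have h4 : gaussPrim s 1 = slabMass s / 2 := by rw [slabMass_eq]; ring
        have := slabMass_pos s
        rw [hk, h4]
        field_simp
      rw [abs_mul, abs_of_pos hk0, ← h3]
      exact mul_lt_mul_of_pos_left (abs_lt.2 ⟨h2, h1⟩) hk0
    have h1 := e.hasDerivAt_symm htarget (Real.exp_pos _).ne'
      (hasStrictDerivAt_gaussPrim 1 _).hasDerivAt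
    have h2 := (hasStrictDerivAt_gaussPrim s x).hasDerivAt.const_mul k
    refine (h1.comp x h2).congr_deriv ?_
    rw [← Real.exp_neg]
    ring_nf

/-! ### Barthe's transport in dimension `n` and the Gaussian form of Ball's inequality -/

/-- The open polytope `{|⟨uᵢ, y⟩| < 1}`. -/
def openSlabs {n : ℕ} {ι : Type} (u : ι → EuclideanSpace ℝ (Fin n)) :
    Set (EuclideanSpace ℝ (Fin n)) := {y | ∀ i, |⟪u i, y⟫| < 1}

/-- Barthe's transport map `y ↦ ∑ cᵢ T ⟨uᵢ, y⟩ uᵢ`. -/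
noncomputable def transportMap {n : ℕ} {ι : Type} [Fintype ι] (c : ι → ℝ)
    (u : ι → EuclideanSpace ℝ (Fin n)) (T : ℝ → ℝ) (y : EuclideanSpace ℝ (Fin n)) :
    EuclideanSpace ℝ (Fin n) := ∑ i, (c i * T ⟪u i, y⟫) • u i

/-- `T` solves the differential equation of the transport of `exp (-s x²)` on `(-1, 1)` to the
Gaussian density. -/
def IsGaussianTransport (s : ℝ) (T : ℝ → ℝ) : Prop := ∀ x ∈ Ioo (-1 : ℝ) 1,
  HasDerivAt T (√Real.pi / slabMass s * Real.exp (T x ^ 2) * Real.exp (-s * x ^ 2)) x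

section

variable {n : ℕ} {ι : Type} {u : ι → EuclideanSpace ℝ (Fin n)} {s : ℝ} {T : ℝ → ℝ}

theorem mem_Ioo_of_mem_openSlabs {y : EuclideanSpace ℝ (Fin n)} (hy : y ∈ openSlabs u) (i : ι) :
    ⟪u i, y⟫ ∈ Ioo (-1 : ℝ) 1 := abs_lt.1 (hy i)

theorem IsGaussianTransport.deriv_factor_pos (s : ℝ) (T : ℝ → ℝ) (x : ℝ) :
    0 < √Real.pi / slabMass s * Real.exp (T x ^ 2) * Real.exp (-s * x ^ 2) := by
  have := slabMass_pos s
  have := Real.sqrt_pos.2 Real.pi_pos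
  positivity

theorem IsGaussianTransport.continuousOn (hT : IsGaussianTransport s T) :
    ContinuousOn T (Ioo (-1) 1) := fun x hx => (hT x hx).continuousAt.continuousWithinAt

theorem IsGaussianTransport.strictMonoOn (hT : IsGaussianTransport s T) :
    StrictMonoOn T (Ioo (-1) 1) := by
  refine strictMonoOn_of_deriv_pos (convex_Ioo _ _) hT.continuousOn fun x hx => ?_
  rw [interior_Ioo] at hx
  rw [(hT x hx).deriv]
  exact deriv_factor_pos s T x

theorem IsGaussianTransport.hasFDerivAt_comp_inner (hT : IsGaussianTransport s T)
    {y : EuclideanSpace ℝ (Fin n)} (hy : y ∈ openSlabs u) (i : ι) :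
    HasFDerivAt (fun z => T ⟪u i, z⟫)
      ((√Real.pi / slabMass s * Real.exp (T ⟪u i, y⟫ ^ 2) * Real.exp (-s * ⟪u i, y⟫ ^ 2)) •
        innerSL ℝ (u i)) y := by
  have h1 : HasFDerivAt (fun z => ⟪u i, z⟫) (innerSL ℝ (u i)) y := (innerSL ℝ (u i)).hasFDerivAt
  exact (hT _ (mem_Ioo_of_mem_openSlabs hy i)).comp_hasFDerivAt y h1

variable [Fintype ι] {c : ι → ℝ}

theorem isOpen_openSlabs (u : ι → EuclideanSpace ℝ (Fin n)) : IsOpen (openSlabs u) := by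
  have : openSlabs u = ⋂ i, {y | |⟪u i, y⟫| < 1} := by ext y; simp [openSlabs]
  rw [this]
  exact isOpen_iInter_of_finite fun i => isOpen_lt (by fun_prop) (by fun_prop)

theorem IsGaussianTransport.hasFDerivAt_transportMap (hT : IsGaussianTransport s T) (c : ι → ℝ)
    {y : EuclideanSpace ℝ (Fin n)} (hy : y ∈ openSlabs u) :
    HasFDerivAt (transportMap c u T) (frameOp c u fun i =>
      √Real.pi / slabMass s * Real.exp (T ⟪u i, y⟫ ^ 2) * Real.exp (-s * ⟪u i, y⟫ ^ 2)) y := by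
  refine (HasFDerivAt.fun_sum (u := Finset.univ) fun i _ =>
    ((hT.hasFDerivAt_comp_inner hy i).const_mul (c i)).smul_const (u i)).congr_fderiv ?_
  rw [frameOp]
  refine Finset.sum_congr rfl fun i _ => ?_
  ext z
  simp [smul_smul, mul_assoc]

/-- Monotonicity of `T` makes `⟪Φ y - Φ z, y - z⟫` a sum of nonnegative terms, where `Φ` is the
transport map. If it vanishes, strictness gives `⟪uᵢ, y⟫ = ⟪uᵢ, z⟫` for all `i`. -/
theorem IsGaussianTransport.injOn_transportMap (hT : IsGaussianTransport s T)
    (h : IsJohnFrame c u) : InjOn (transportMap c u T) (openSlabs u) := by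
  intro y hy z hz hyz
  have h0 : ∑ i, c i * ((T ⟪u i, y⟫ - T ⟪u i, z⟫) * (⟪u i, y⟫ - ⟪u i, z⟫)) = 0 := by
    have h1 : ⟪transportMap c u T y - transportMap c u T z, y - z⟫ = 0 := by
      rw [hyz, sub_self, inner_zero_left]
    rw [← h1, transportMap, transportMap, ← Finset.sum_sub_distrib, sum_inner]
    refine Finset.sum_congr rfl fun i _ => ?_
    rw [← sub_smul, real_inner_smul_left, inner_sub_right]
    ring
  have hnn : ∀ i, 0 ≤ (T ⟪u i, y⟫ - T ⟪u i, z⟫) * (⟪u i, y⟫ - ⟪u i, z⟫) := by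
    intro i
    have hm := hT.strictMonoOn.monotoneOn
    have hy' := mem_Ioo_of_mem_openSlabs hy i
    have hz' := mem_Ioo_of_mem_openSlabs hz i
    rcases le_total ⟪u i, y⟫ ⟪u i, z⟫ with hle | hle
    · exact mul_nonneg_of_nonpos_of_nonpos (sub_nonpos.2 (hm hy' hz' hle)) (sub_nonpos.2 hle)
    · exact mul_nonneg (sub_nonneg.2 (hm hz' hy' hle)) (sub_nonneg.2 hle)
  rw [Finset.sum_eq_zero_iff_of_nonneg fun i _ => mul_nonneg (h.pos i).le (hnn i)] at h0
  refine sub_eq_zero.1 (h.eq_zero_of_inner_eq_zero fun i => ?_)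
  rw [inner_sub_right]
  have hi := h0 i (Finset.mem_univ i)
  rcases mul_eq_zero.1 ((mul_eq_zero.1 hi).resolve_left (h.pos i).ne') with h2 | h2
  · exact sub_eq_zero.2 (hT.strictMonoOn.injOn (mem_Ioo_of_mem_openSlabs hy i)
      (mem_Ioo_of_mem_openSlabs hz i) (sub_eq_zero.1 h2))
  · exact h2

theorem integral_gaussian_norm (n : ℕ) :
    ∫⁻ z : EuclideanSpace ℝ (Fin n), ENNReal.ofReal (Real.exp (-‖z‖ ^ 2)) =
      ENNReal.ofReal (√Real.pi ^ n) := by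
  have h1 := GaussianFourier.integral_rexp_neg_mul_sq_norm
    (V := EuclideanSpace ℝ (Fin n)) (b := 1) one_pos
  have h2 : (Real.pi / 1) ^ (Module.finrank ℝ (EuclideanSpace ℝ (Fin n)) / 2 : ℝ) =
      √Real.pi ^ n := by
    rw [div_one, finrank_euclideanSpace_fin, Real.sqrt_eq_rpow, ← Real.rpow_natCast,
      ← Real.rpow_mul Real.pi_pos.le]
    ring_nf
  rw [h2] at h1
  simp only [neg_one_mul] at h1
  rw [← h1, ofReal_integral_eq_lintegral_ofReal]
  · by_contra hint
    rw [integral_undef hint] at h1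
    have : 0 < √Real.pi ^ n := pow_pos (Real.sqrt_pos.2 Real.pi_pos) n
    exact this.ne h1
  · exact Eventually.of_forall fun z => (Real.exp_pos _).le

/-- The determinant inequality along the transport. -/
theorem IsJohnFrame.exp_mul_le_det (h : IsJohnFrame c u) (s : ℝ) (T : ℝ → ℝ)
    (y : EuclideanSpace ℝ (Fin n)) :
    (√Real.pi / slabMass s) ^ n * Real.exp (∑ i, c i * T ⟪u i, y⟫ ^ 2) *
        Real.exp (-s * ‖y‖ ^ 2) ≤
      (frameOp c u fun i =>
        √Real.pi / slabMass s * Real.exp (T ⟪u i, y⟫ ^ 2) * Real.exp (-s * ⟪u i, y⟫ ^ 2)).det := by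
  refine le_of_eq_of_le ?_ (h.prod_rpow_le_det
    fun i => IsGaussianTransport.deriv_factor_pos s T _)
  set k := √Real.pi / slabMass s
  have hk : 0 < k := div_pos (Real.sqrt_pos.2 Real.pi_pos) (slabMass_pos s)
  have : ∀ i, (k * Real.exp (T ⟪u i, y⟫ ^ 2) * Real.exp (-s * ⟪u i, y⟫ ^ 2)) ^ c i =
      k ^ c i * Real.exp (c i * T ⟪u i, y⟫ ^ 2) * Real.exp (-s * (c i * ⟪u i, y⟫ ^ 2)) := by
    intro i
    rw [Real.mul_rpow (by positivity) (by positivity), Real.mul_rpow (by positivity)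
      (by positivity), ← Real.exp_mul, ← Real.exp_mul]
    ring_nf
  simp only [this]
  rw [Finset.prod_mul_distrib, Finset.prod_mul_distrib, ← Real.rpow_sum_of_pos hk,
    ← Real.exp_sum, ← Real.exp_sum, ← Finset.mul_sum, h.sum_mul_inner_sq, h.sum_weights,
    Real.rpow_natCast]

/-- The transport estimate behind Ball's inequality, with its defect. -/
theorem IsJohnFrame.lintegral_openSlabs_defect_le (h : IsJohnFrame c u)
    (hT : IsGaussianTransport s T) :
    ∫⁻ y in openSlabs u, ENNReal.ofReal (Real.exp (-s * ‖y‖ ^ 2) *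
        Real.exp (∑ i, c i * T ⟪u i, y⟫ ^ 2 - ‖transportMap c u T y‖ ^ 2)) ≤
      ENNReal.ofReal (slabMass s ^ n) := by
  set k := √Real.pi / slabMass s with hk'
  have hs := slabMass_pos s
  have hpi := Real.sqrt_pos.2 Real.pi_pos
  have hk : 0 < k := div_pos hpi hs
  set D : EuclideanSpace ℝ (Fin n) → EuclideanSpace ℝ (Fin n) →L[ℝ] EuclideanSpace ℝ (Fin n) :=
    fun y => frameOp c u fun i =>
      k * Real.exp (T ⟪u i, y⟫ ^ 2) * Real.exp (-s * ⟪u i, y⟫ ^ 2)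
  have hchange := lintegral_image_eq_lintegral_abs_det_fderiv_mul volume
    (isOpen_openSlabs u).measurableSet
    (fun y hy => (hT.hasFDerivAt_transportMap c hy).hasFDerivWithinAt)
    (hT.injOn_transportMap h) fun z => ENNReal.ofReal (Real.exp (-‖z‖ ^ 2))
  have hle : ∫⁻ y in openSlabs u, ENNReal.ofReal |(D y).det| *
      ENNReal.ofReal (Real.exp (-‖transportMap c u T y‖ ^ 2)) ≤ ENNReal.ofReal (√Real.pi ^ n) := by
    rw [← integral_gaussian_norm n]
    -- Only an upper bound is wanted, so the image of the polytope need not be all of the space.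
    exact hchange.symm.le.trans (setLIntegral_le_lintegral _ _)
  calc _ ≤ ∫⁻ y in openSlabs u, ENNReal.ofReal ((k ^ n)⁻¹) * (ENNReal.ofReal |(D y).det| *
      ENNReal.ofReal (Real.exp (-‖transportMap c u T y‖ ^ 2))) := by
        refine lintegral_mono fun y => ?_
        rw [← ENNReal.ofReal_mul (abs_nonneg _), ← ENNReal.ofReal_mul (by positivity)]
        refine ENNReal.ofReal_le_ofReal ?_
        have h1 : k ^ n * Real.exp (∑ i, c i * T ⟪u i, y⟫ ^ 2) * Real.exp (-s * ‖y‖ ^ 2) ≤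
            |(D y).det| := (h.exp_mul_le_det s T y).trans (le_abs_self _)
        rw [sub_eq_add_neg, Real.exp_add]
        calc _ = (k ^ n)⁻¹ * ((k ^ n * Real.exp (∑ i, c i * T ⟪u i, y⟫ ^ 2) *
              Real.exp (-s * ‖y‖ ^ 2)) * Real.exp (-‖transportMap c u T y‖ ^ 2)) := by
              field_simp
          _ ≤ _ := by gcongr
    _ = ENNReal.ofReal ((k ^ n)⁻¹) * ∫⁻ y in openSlabs u, (ENNReal.ofReal |(D y).det| *
      ENNReal.ofReal (Real.exp (-‖transportMap c u T y‖ ^ 2))) :=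
        lintegral_const_mul' _ _ ENNReal.ofReal_ne_top
    _ ≤ ENNReal.ofReal ((k ^ n)⁻¹) * ENNReal.ofReal (√Real.pi ^ n) := by gcongr
    _ = _ := by
        rw [← ENNReal.ofReal_mul (by positivity), hk', div_pow]
        congr 1
        field_simp

/-- The defect is a weighted sum of the squares `(T⟪uᵢ, y⟫ - ⟪uᵢ, Φ y⟫)²`, with `Φ` the transport
map. This form also settles the equality case. -/
theorem IsJohnFrame.norm_transportMap_sq_le (h : IsJohnFrame c u) (T : ℝ → ℝ)
    (y : EuclideanSpace ℝ (Fin n)) :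
    0 ≤ ∑ i, c i * T ⟪u i, y⟫ ^ 2 - ‖transportMap c u T y‖ ^ 2 := by
  rw [transportMap, ← h.sum_mul_sub_inner_sq]
  exact Finset.sum_nonneg fun i _ => mul_nonneg (h.pos i).le (sq_nonneg _)

/-- Ball's inequality with a Gaussian weight. -/
theorem IsJohnFrame.lintegral_openSlabs_le (h : IsJohnFrame c u) (s : ℝ) :
    ∫⁻ y in openSlabs u, ENNReal.ofReal (Real.exp (-s * ‖y‖ ^ 2)) ≤
      ENNReal.ofReal (slabMass s ^ n) := by
  obtain ⟨T, -, hT⟩ := exists_gaussian_transport s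
  refine le_trans (lintegral_mono fun y => ENNReal.ofReal_le_ofReal ?_)
    (h.lintegral_openSlabs_defect_le hT)
  exact le_mul_of_one_le_right (Real.exp_pos _).le
    (Real.one_le_exp (h.norm_transportMap_sq_le T y))

/-! ### Equality in the transport estimate -/

theorem IsGaussianTransport.continuousOn_transportMap (hT : IsGaussianTransport s T) (c : ι → ℝ) :
    ContinuousOn (transportMap c u T) (openSlabs u) := fun _ hy =>
  (hT.hasFDerivAt_transportMap c hy).continuousAt.continuousWithinAt

/-- In the equality case the transport is diagonal in every direction of the frame. -/
theorem IsJohnFrame.transport_eq_inner_of_le (h : IsJohnFrame c u) (hT : IsGaussianTransport s T)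
    (heq : ENNReal.ofReal (slabMass s ^ n) ≤
      ∫⁻ y in openSlabs u, ENNReal.ofReal (Real.exp (-s * ‖y‖ ^ 2)))
    {y : EuclideanSpace ℝ (Fin n)} (hy : y ∈ openSlabs u) (i : ι) :
    T ⟪u i, y⟫ = ⟪u i, transportMap c u T y⟫ := by
  set d : EuclideanSpace ℝ (Fin n) → ℝ := fun y =>
    ∑ i, c i * T ⟪u i, y⟫ ^ 2 - ‖transportMap c u T y‖ ^ 2 with hd
  have hTc : ∀ i, ContinuousOn (fun y => T ⟪u i, y⟫) (openSlabs u) := fun i y hy =>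
    (hT.hasFDerivAt_comp_inner hy i).continuousAt.continuousWithinAt
  have hdc : ContinuousOn d (openSlabs u) :=
    (continuousOn_finsetSum _ fun i _ => continuousOn_const.mul ((hTc i).pow 2)).sub
      ((hT.continuousOn_transportMap c).norm.pow 2)
  have hfc : Continuous fun y : EuclideanSpace ℝ (Fin n) => Real.exp (-s * ‖y‖ ^ 2) := by fun_prop
  have hgc : ContinuousOn (fun y => Real.exp (-s * ‖y‖ ^ 2) * Real.exp (d y)) (openSlabs u) :=
    hfc.continuousOn.mul hdc.rexp
  have hmeas := (isOpen_openSlabs u).measurableSet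
  -- The integrand with the defect dominates the one without, yet its integral is no larger by
  -- `heq`. The two agree almost everywhere, and by continuity everywhere on the open polytope.
  have hae := ae_eq_of_ae_le_of_lintegral_le (μ := volume.restrict (openSlabs u))
    (f := fun y => ENNReal.ofReal (Real.exp (-s * ‖y‖ ^ 2)))
    (g := fun y => ENNReal.ofReal (Real.exp (-s * ‖y‖ ^ 2) * Real.exp (d y)))
    (Eventually.of_forall fun y => ENNReal.ofReal_le_ofReal
      (le_mul_of_one_le_right (Real.exp_pos _).le
        (Real.one_le_exp (h.norm_transportMap_sq_le T y))))
    (ne_top_of_le_ne_top ENNReal.ofReal_ne_top (h.lintegral_openSlabs_le s))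
    (hgc.aemeasurable hmeas).ennreal_ofReal
    ((h.lintegral_openSlabs_defect_le hT).trans heq)
  have hEq : EqOn (fun y => Real.exp (-s * ‖y‖ ^ 2))
      (fun y => Real.exp (-s * ‖y‖ ^ 2) * Real.exp (d y)) (openSlabs u) := by
    refine Measure.eqOn_open_of_ae_eq (μ := volume) ?_ (isOpen_openSlabs u) hfc.continuousOn hgc
    filter_upwards [hae] with y hy
    exact (ENNReal.ofReal_eq_ofReal_iff (by positivity) (by positivity)).1 hy
  have h1 : Real.exp (d y) = 1 := by
    have := hEq hy
    simp only at this
    exact (mul_eq_left₀ (Real.exp_pos _).ne').1 this.symm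
  have h2 : d y = 0 := Real.exp_eq_one_iff _ |>.1 h1
  rw [hd] at h2
  simp only at h2
  rw [transportMap, ← h.sum_mul_sub_inner_sq,
    Finset.sum_eq_zero_iff_of_nonneg fun i _ => mul_nonneg (h.pos i).le (sq_nonneg _)] at h2
  have h3 := (mul_eq_zero.1 (h2 i (Finset.mem_univ i))).resolve_left (h.pos i).ne'
  exact sub_eq_zero.1 (pow_eq_zero_iff two_ne_zero |>.1 h3)

/-- Equality in Ball's inequality forces the frame vectors to be pairwise parallel or
orthogonal. -/
theorem IsJohnFrame.parallel_or_orthogonal (h : IsJohnFrame c u)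
    (heq : ENNReal.ofReal (2 ^ n) ≤ volume (openSlabs u)) (i j : ι) :
    u i = u j ∨ u i = -u j ∨ ⟪u i, u j⟫ = 0 := by
  obtain ⟨T, hT0, hT⟩ := exists_gaussian_transport 0
  change IsGaussianTransport 0 T at hT
  have heq' : ENNReal.ofReal (slabMass 0 ^ n) ≤
      ∫⁻ y in openSlabs u, ENNReal.ofReal (Real.exp (-0 * ‖y‖ ^ 2)) := by
    simpa [slabMass_zero] using heq
  by_contra! hcon
  obtain ⟨hne, hne', hno⟩ := hcon
  set r := ⟪u i, u j⟫ with hr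
  set v := u i - r • u j with hv
  have hvj : ⟪u j, v⟫ = 0 := by
    rw [hv, inner_sub_right, real_inner_smul_right, real_inner_self_eq_norm_sq, h.norm,
      real_inner_comm, ← hr]
    ring
  have hvi : ⟪u i, v⟫ = 1 - r ^ 2 := by
    rw [hv, inner_sub_right, real_inner_smul_right, real_inner_self_eq_norm_sq, h.norm, ← hr]
    ring
  have hvn : ‖v‖ ^ 2 = 1 - r ^ 2 := by
    rw [← real_inner_self_eq_norm_sq]
    conv_lhs => rw [hv]
    rw [inner_sub_left, hvi, real_inner_smul_left, hvj]
    ring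
  have hr1 : 1 - r ^ 2 ≠ 0 := by
    intro h0
    have h1 : (1 - r) * (1 + r) = 0 := by linarith
    rcases mul_eq_zero.1 h1 with h2 | h2
    · exact hne ((inner_eq_one_iff_of_norm_eq_one (𝕜 := ℝ) (h.norm i) (h.norm j)).1 (by linarith))
    · apply hne'
      refine (inner_eq_one_iff_of_norm_eq_one (𝕜 := ℝ) (h.norm i) (by rw [norm_neg, h.norm])).1 ?_
      rw [inner_neg_right]; linarith
  -- A point orthogonal to `u j` but not to `u i`; the factor `1 / 2` keeps it inside the polytope.
  set y := (1 / 2 : ℝ) • v with hy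
  have hyΩ : y ∈ openSlabs u := by
    intro k
    have h1 : |⟪u k, y⟫| ≤ ‖u k‖ * ‖y‖ := abs_real_inner_le_norm _ _
    have h2 : ‖v‖ ≤ 1 := by nlinarith [norm_nonneg v, sq_nonneg r]
    rw [h.norm, one_mul, hy, norm_smul] at h1
    norm_num at h1
    linarith
  have hyj : ⟪u j, y⟫ = 0 := by rw [hy, real_inner_smul_right, hvj, mul_zero]
  have hyi : ⟪u i, y⟫ ≠ 0 := by
    rw [hy, real_inner_smul_right, hvi]
    simpa using hr1
  have hTi : T ⟪u i, y⟫ ≠ 0 := by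
    rw [← hT0]
    exact fun h0 => hyi (hT.strictMonoOn.injOn (mem_Ioo_of_mem_openSlabs hyΩ i)
      (by norm_num) h0)
  set t : ι → ℝ := fun i => √Real.pi / slabMass 0 * Real.exp (T ⟪u i, y⟫ ^ 2) *
    Real.exp (-0 * ⟪u i, y⟫ ^ 2) with ht
  -- Differentiating `T⟪u k, z⟫ = ⟪u k, transportMap c u T z⟫` at `y`. Since the derivative `frameOp
  -- c u t` is symmetric, `u k` is an eigenvector with eigenvalue `t k`.
  have key : ∀ k w, t k * ⟪u k, w⟫ = ⟪u k, frameOp c u t w⟫ := by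
    intro k w
    have h1 := hT.hasFDerivAt_comp_inner hyΩ k
    have h2 : HasFDerivAt (fun z => ⟪u k, transportMap c u T z⟫)
        ((innerSL ℝ (u k)).comp (frameOp c u t)) y :=
      (innerSL ℝ (u k)).hasFDerivAt.comp y (hT.hasFDerivAt_transportMap c hyΩ)
    have h3 : (fun z => T ⟪u k, z⟫) =ᶠ[𝓝 y] fun z => ⟪u k, transportMap c u T z⟫ := by
      filter_upwards [(isOpen_openSlabs u).mem_nhds hyΩ] with z hz
      exact h.transport_eq_inner_of_le hT heq' hz k
    have h4 := congrArg (fun L => L w) (h1.unique (h2.congr_of_eventuallyEq h3))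
    simpa [ht] using h4
  have k1 := key i (u j)
  have k2 := key j (u i)
  have k3 : ⟪u j, frameOp c u t (u i)⟫ = ⟪u i, frameOp c u t (u j)⟫ := by
    rw [real_inner_comm]; exact isSymmetric_frameOp t (u i) (u j)
  rw [k3, ← k1, real_inner_comm] at k2
  -- Non-orthogonal eigenvectors share their eigenvalue. At `s = 0` the eigenvalue is a constant
  -- times `exp (T²)`, so `T⟪u i, y⟫ ^ 2 = T 0 ^ 2 = 0`, a contradiction.
  have k4 : t j = t i := mul_right_cancel₀ hno k2
  have hk : √Real.pi / slabMass 0 ≠ 0 :=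
    (div_pos (Real.sqrt_pos.2 Real.pi_pos) (slabMass_pos 0)).ne'
  simp only [ht, hyj, hT0, neg_zero, zero_mul, Real.exp_zero, mul_one] at k4
  have k5 := mul_left_cancel₀ hk k4
  rw [Real.exp_eq_exp] at k5
  exact hTi (by simpa using k5.symm)

end

/-! ### From the polytope to the body and the rotated cube -/

section

variable {n : ℕ} {ι : Type} {u : ι → EuclideanSpace ℝ (Fin n)}
  {K : Set (EuclideanSpace ℝ (Fin n))}

theorem interior_subset_openSlabs (hK : ∀ i, ∀ x ∈ K, |⟪u i, x⟫| ≤ 1) :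
    interior K ⊆ openSlabs u := by
  intro y hy i
  have hc : ContinuousAt (fun r : ℝ => r • y) 1 := by fun_prop
  have h1 : ∀ᶠ r : ℝ in 𝓝 1, r • y ∈ interior K :=
    hc.eventually_mem (by simpa using isOpen_interior.mem_nhds hy)
  obtain ⟨r, hr, hr1⟩ := ((h1.filter_mono nhdsWithin_le_nhds).and
    (self_mem_nhdsWithin : Ioi (1 : ℝ) ∈ 𝓝[>] (1 : ℝ))).exists
  have h2 := hK i _ (interior_subset hr)
  rw [real_inner_smul_right, abs_mul, abs_of_pos (one_pos.trans hr1)] at h2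
  have hr1' : 1 < r := hr1
  nlinarith [abs_nonneg ⟪u i, y⟫]

theorem IsSymmConvexBody.interior_ae_eq (hK : IsSymmConvexBody K) :
    interior K =ᵐ[volume] K :=
  interior_ae_eq_of_null_frontier (hK.convex.addHaar_frontier volume)

variable [Fintype ι] {c : ι → ℝ}

theorem lintegral_exp_le (h : IsJohnFrame c u) (hK : IsSymmConvexBody K)
    (hKu : ∀ i, ∀ x ∈ K, |⟪u i, x⟫| ≤ 1) (s : ℝ) :
    ∫⁻ y in K, ENNReal.ofReal (Real.exp (-s * ‖y‖ ^ 2)) ≤ ENNReal.ofReal (slabMass s ^ n) := by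
  rw [← setLIntegral_congr hK.interior_ae_eq]
  exact (lintegral_mono_set (interior_subset_openSlabs hKu)).trans (h.lintegral_openSlabs_le s)

theorem volume_openSlabs_le (h : IsJohnFrame c u) :
    volume (openSlabs u) ≤ ENNReal.ofReal (2 ^ n) := by
  simpa [slabMass_zero] using h.lintegral_openSlabs_le 0

/-- In the equality case `K` is the whole polytope cut out by the frame. -/
theorem eq_slabs_of_volume_le (h : IsJohnFrame c u) (hK : IsSymmConvexBody K)
    (hKu : ∀ i, ∀ x ∈ K, |⟪u i, x⟫| ≤ 1) (hvol : ENNReal.ofReal (2 ^ n) ≤ volume K) :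
    K = {x | ∀ i, |⟪u i, x⟫| ≤ 1} := by
  refine Subset.antisymm (fun x hx i => hKu i x hx) ?_
  have hcl := hK.isCompact.isClosed
  have hΩ : openSlabs u ⊆ K := by
    have h1 : volume (openSlabs u \ interior K) = 0 := by
      rw [measure_sdiff (interior_subset_openSlabs hKu)
        isOpen_interior.measurableSet.nullMeasurableSet, tsub_eq_zero_iff_le,
        measure_congr hK.interior_ae_eq]
      · exact (volume_openSlabs_le h).trans hvol
      · rw [measure_congr hK.interior_ae_eq]
        exact hK.isCompact.measure_lt_top.ne
    have h2 : volume (openSlabs u \ K) = 0 :=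
      measure_mono_null (sdiff_subset_sdiff_right interior_subset) h1
    -- What the closed set `K` misses of the open polytope is open, so being null it is empty.
    have h3 := ((isOpen_openSlabs u).sdiff hcl).eq_empty_of_measure_zero h2
    exact sdiff_eq_empty.1 h3
  intro x hx
  have hlim : Tendsto (fun r : ℝ => r • x) (𝓝[<] 1) (𝓝 x) := by
    have : Tendsto (fun r : ℝ => r • x) (𝓝 1) (𝓝 ((1 : ℝ) • x)) :=
      (by fun_prop : Continuous fun r : ℝ => r • x).tendsto 1
    rw [one_smul] at this
    exact this.mono_left nhdsWithin_le_nhds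
  refine hcl.mem_of_tendsto hlim ?_
  filter_upwards [Ioo_mem_nhdsLT (show (0 : ℝ) < 1 from one_pos)] with r hr
  refine hΩ fun i => ?_
  rw [real_inner_smul_right, abs_mul, abs_of_pos hr.1]
  exact (mul_le_of_le_one_right hr.1.le (hx i)).trans_lt hr.2

/-- A frame of pairwise parallel or orthogonal vectors comes from an orthonormal basis. -/
theorem IsJohnFrame.exists_orthonormalBasis (h : IsJohnFrame c u)
    (hpo : ∀ i j, u i = u j ∨ u i = -u j ∨ ⟪u i, u j⟫ = 0) :
    ∃ b : OrthonormalBasis (Fin n) ℝ (EuclideanSpace ℝ (Fin n)),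
      ∀ x, (∀ i, |⟪u i, x⟫| ≤ 1) ↔ ∀ k, |⟪b k, x⟫| ≤ 1 := by
  classical
  -- One representative from each class of vectors equal up to sign gives an orthonormal family,
  -- spanning because the frame does.
  let S : Setoid ι :=
    { r := fun i j => u i = u j ∨ u i = -u j
      iseqv :=
        { refl := fun i => Or.inl rfl
          symm := by
            rintro i j (hij | hij)
            · exact Or.inl hij.symm
            · exact Or.inr (by rw [hij, neg_neg])
          trans := by
            rintro i j k (hij | hij) (hjk | hjk)
            · exact Or.inl (hij.trans hjk)
            · exact Or.inr (hij.trans hjk)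
            · exact Or.inr (by rw [hij, hjk])
            · exact Or.inl (by rw [hij, hjk, neg_neg]) } }
  let w : Quotient S → EuclideanSpace ℝ (Fin n) := fun q => u q.out
  have hrel : ∀ i, u i = w (Quotient.mk S i) ∨ u i = -w (Quotient.mk S i) := fun i =>
    S.symm (Quotient.mk_out (s := S) i)
  have hon : Orthonormal ℝ w := by
    refine ⟨fun q => h.norm _, fun q q' hq => ?_⟩
    rcases hpo q.out q'.out with h1 | h1 | h1
    · exact absurd (Quotient.out_equiv_out.1 (Or.inl h1)) hq
    · exact absurd (Quotient.out_equiv_out.1 (Or.inr h1)) hq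
    · exact h1
  have hsp : (Submodule.span ℝ (range w))ᗮ = ⊥ := by
    rw [Submodule.eq_bot_iff]
    intro x hx
    rw [Submodule.mem_orthogonal] at hx
    have hwx : ∀ q, ⟪w q, x⟫ = 0 := fun q => hx _ (Submodule.subset_span (mem_range_self q))
    refine h.eq_zero_of_inner_eq_zero fun i => ?_
    rcases hrel i with h1 | h1 <;> simp [h1, hwx]
  let b := OrthonormalBasis.mkOfOrthogonalEqBot hon hsp
  have hb : ∀ q, b q = w q := fun q => by simp [b]
  have hcard : Fintype.card (Quotient S) = Fintype.card (Fin n) := by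
    rw [← Module.finrank_eq_card_basis b.toBasis, finrank_euclideanSpace]
  let e := Fintype.equivOfCardEq hcard
  refine ⟨b.reindex e, fun x => ?_⟩
  simp only [OrthonormalBasis.reindex_apply, hb]
  constructor
  · exact fun hx k => hx _
  · intro hx i
    have h1 := hx (e (Quotient.mk S i))
    rw [e.symm_apply_apply] at h1
    rcases hrel i with h2 | h2
    · rwa [h2]
    · rwa [h2, inner_neg_left, abs_neg]

/-- Flipping the sign of a basis vector leaves its slab unchanged, so the basis can be oriented to
make the isometry have determinant one. -/
theorem isRotationOf_cube_of_orthonormalBasis (hn : 1 ≤ n)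
    (b : OrthonormalBasis (Fin n) ℝ (EuclideanSpace ℝ (Fin n))) :
    IsRotationOf {x | ∀ k, |⟪b k, x⟫| ≤ 1} (cube n) := by
  have : Nonempty (Fin n) := ⟨⟨0, hn⟩⟩
  set e := EuclideanSpace.basisFun (Fin n) ℝ
  set b' := b.adjustToOrientation e.toBasis.orientation
  have hb' : ∀ k, b' k = b k ∨ b' k = -b k :=
    b.adjustToOrientation_apply_eq_or_eq_neg e.toBasis.orientation
  have hdet : e.toBasis.det b' = 1 := by
    apply e.det_to_matrix_orthonormalBasis_of_same_orientation
    rw [b.orientation_adjustToOrientation]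
  refine ⟨b'.repr.symm, ?_, ?_⟩
  · have h1 := e.toBasis.det_comp
      (b'.repr.symm.toLinearEquiv : EuclideanSpace ℝ (Fin n) →ₗ[ℝ] EuclideanSpace ℝ (Fin n))
      e.toBasis
    rw [Module.Basis.det_self, mul_one] at h1
    rw [← h1, ← hdet]
    congr 1
  · have hset : {x | ∀ k, |⟪b k, x⟫| ≤ 1} = {x | ∀ k, |⟪b' k, x⟫| ≤ 1} := by
      ext x
      refine forall_congr' fun k => ?_
      rcases hb' k with h1 | h1
      · rw [h1]
      · rw [h1, inner_neg_left, abs_neg]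
    rw [hset]
    ext x
    rw [mem_image]
    constructor
    · intro hx
      refine ⟨b'.repr x, fun k => ?_, by simp⟩
      rw [b'.repr_apply_apply]
      exact hx k
    · rintro ⟨z, hz, rfl⟩ k
      rw [← b'.repr_apply_apply, LinearIsometryEquiv.apply_symm_apply]
      exact hz k

end

section

variable {n : ℕ} {K : Set (EuclideanSpace ℝ (Fin n))}

theorem isRotationOf_cube_of_volume_le (hn : 1 ≤ n) (hK : IsSymmConvexBody K)
    (hJ : InJohnPosition K) (hvol : ENNReal.ofReal (2 ^ n) ≤ volume K) :
    IsRotationOf K (cube n) := by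
  obtain ⟨ι, _, c, u, h, hKu⟩ := exists_johnFrame hn hK hJ
  have hΩ : ENNReal.ofReal (2 ^ n) ≤ volume (openSlabs u) := by
    refine hvol.trans ?_
    rw [← measure_congr hK.interior_ae_eq]
    exact measure_mono (interior_subset_openSlabs hKu)
  obtain ⟨b, hb⟩ := h.exists_orthonormalBasis fun i j => h.parallel_or_orthogonal hΩ i j
  have hKb : K = {x | ∀ k, |⟪b k, x⟫| ≤ 1} := by
    rw [eq_slabs_of_volume_le h hK hKu hvol]
    ext x
    exact hb x
  rw [hKb]
  exact isRotationOf_cube_of_orthonormalBasis hn b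

/-! ### The Gaussian mass of the cube -/

theorem lintegral_exp_cube (n : ℕ) (s : ℝ) :
    ∫⁻ y in cube n, ENNReal.ofReal (Real.exp (-s * ‖y‖ ^ 2)) = ENNReal.ofReal (slabMass s ^ n) := by
  have hcube : MeasurableSet (cube n) := by
    have : cube n = ⋂ i, {x : EuclideanSpace ℝ (Fin n) | |x i| ≤ 1} := by ext; simp [cube]
    rw [this]
    exact MeasurableSet.iInter fun i => measurableSet_le (by fun_prop) (by fun_prop)
  set g : ℝ → ℝ := (Icc (-1 : ℝ) 1).indicator fun t => Real.exp (-s * t ^ 2) with hg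
  have hc : Continuous fun t : ℝ => Real.exp (-s * t ^ 2) := by fun_prop
  have hg0 : ∀ t, 0 ≤ g t := fun t => indicator_nonneg (fun t _ => (Real.exp_pos _).le) t
  have hgi : Integrable g := by
    rw [hg, integrable_indicator_iff measurableSet_Icc]
    exact hc.continuousOn.integrableOn_Icc
  have hslab : ∫ t, g t = slabMass s := by
    rw [hg, integral_indicator measurableSet_Icc, slabMass,
      intervalIntegral.integral_of_le (by norm_num), integral_Icc_eq_integral_Ioc]
  have hprod : ∀ y : Fin n → ℝ, (cube n).indicator
      (fun y => ENNReal.ofReal (Real.exp (-s * ‖y‖ ^ 2))) (WithLp.toLp 2 y) =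
      ENNReal.ofReal (∏ i, g (y i)) := by
    intro y
    by_cases hy : WithLp.toLp 2 y ∈ cube n
    · have hy' : ∀ i, y i ∈ Icc (-1 : ℝ) 1 := fun i => abs_le.1 (hy i)
      rw [indicator_of_mem hy, Finset.prod_congr rfl fun i _ => indicator_of_mem (hy' i) _,
        ← Real.exp_sum, EuclideanSpace.norm_sq_eq, Finset.mul_sum]
      simp
    · rw [indicator_of_notMem hy]
      simp only [cube, mem_ofPred_eq, not_forall] at hy
      obtain ⟨i, hi⟩ := hy
      have hyi : y i ∉ Icc (-1 : ℝ) 1 := fun hi' => hi (abs_le.2 hi')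
      rw [Finset.prod_eq_zero (Finset.mem_univ i) (indicator_of_notMem hyi _), ENNReal.ofReal_zero]
  rw [← lintegral_indicator hcube,
    ← (PiLp.volume_preserving_toLp (Fin n)).lintegral_comp_emb
      (MeasurableEquiv.toLp 2 (Fin n → ℝ)).measurableEmbedding]
  simp_rw [hprod]
  have hpi : Integrable fun y : Fin n → ℝ => ∏ i, g (y i) := Integrable.fintype_prod fun _ => hgi
  rw [← ofReal_integral_eq_lintegral_ofReal hpi
    (Eventually.of_forall fun y => Finset.prod_nonneg fun i _ => hg0 _),
    integral_fintype_prod_volume_eq_pow, hslab, Fintype.card_fin]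

theorem volume_cube (n : ℕ) : volume (cube n) = ENNReal.ofReal (2 ^ n) := by
  simpa [slabMass_zero] using lintegral_exp_cube n 0

theorem lintegral_exp_le_cube (hn : 1 ≤ n) (hK : IsSymmConvexBody K) (hJ : InJohnPosition K)
    (s : ℝ) :
    ∫⁻ y in K, ENNReal.ofReal (Real.exp (-s * ‖y‖ ^ 2)) ≤
      ∫⁻ y in cube n, ENNReal.ofReal (Real.exp (-s * ‖y‖ ^ 2)) := by
  obtain ⟨ι, _, c, u, h, hKu⟩ := exists_johnFrame hn hK hJ
  rw [lintegral_exp_cube]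
  exact lintegral_exp_le h hK hKu s

end

/-! ### Shell masses as mixtures of Gaussian masses -/

/-- The integral of `‖x‖ ^ (q - n)` over the part of `K` outside the unit ball. -/
noncomputable def shellMass {n : ℕ} (q : ℝ) (K : Set (EuclideanSpace ℝ (Fin n))) : ENNReal :=
  ∫⁻ x in K \ unitBall n, ENNReal.ofReal (‖x‖ ^ (q - n))

section

variable {n : ℕ} {K L : Set (EuclideanSpace ℝ (Fin n))}

theorem measurableSet_unitBall (n : ℕ) : MeasurableSet (unitBall n) := measurableSet_closedBall

theorem one_lt_norm_of_mem_sdiff {x : EuclideanSpace ℝ (Fin n)} (hx : x ∈ K \ unitBall n) :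
    1 < ‖x‖ := by
  simpa [unitBall] using hx.2

theorem shellMass_self (K : Set (EuclideanSpace ℝ (Fin n))) :
    shellMass n K = volume (K \ unitBall n) := by
  simp [shellMass]

theorem shellMass_lt_top (hK : IsCompact K) {q : ℝ} (hq : q ≤ n) : shellMass q K < ⊤ := by
  refine lt_of_le_of_lt (setLIntegral_mono' (hK.measurableSet.diff (measurableSet_unitBall n))
    (g := fun _ => 1) fun x hx => ?_) ?_
  · rw [ENNReal.ofReal_le_one]
    exact Real.rpow_le_one_of_one_le_of_nonpos (one_lt_norm_of_mem_sdiff hx).le (by linarith)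
  · rw [setLIntegral_one]
    exact (measure_mono sdiff_subset).trans_lt hK.measure_lt_top

/-- The Gaussian mass of the part of `K` outside the unit ball. -/
noncomputable def gaussShell (K : Set (EuclideanSpace ℝ (Fin n))) (s : ℝ) : ENNReal :=
  ∫⁻ x in K \ unitBall n, ENNReal.ofReal (Real.exp (-s * ‖x‖ ^ 2))

theorem measurable_gaussShell (K : Set (EuclideanSpace ℝ (Fin n))) :
    Measurable (gaussShell K) := by
  unfold gaussShell
  refine Measurable.lintegral_prod_right' (f := fun p : ℝ × EuclideanSpace ℝ (Fin n) =>
    ENNReal.ofReal (Real.exp (-p.1 * ‖p.2‖ ^ 2))) ?_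
  fun_prop

/-- Negative powers of the norm are mixtures of Gaussians. -/
theorem lintegral_rpow_mul_exp_norm {q : ℝ} (hq : q < n) {x : EuclideanSpace ℝ (Fin n)}
    (hx : 0 < ‖x‖) :
    ∫⁻ s in Ioi (0 : ℝ), ENNReal.ofReal (s ^ ((n - q) / 2 - 1)) *
        ENNReal.ofReal (Real.exp (-s * ‖x‖ ^ 2)) =
      ENNReal.ofReal (Real.Gamma ((n - q) / 2)) * ENNReal.ofReal (‖x‖ ^ (q - n)) := by
  have ha : 0 < (n - q) / 2 := by linarith
  have hΓ := Real.Gamma_pos_of_pos ha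
  have h1 := Real.integral_rpow_mul_exp_neg_mul_Ioi ha (pow_pos hx 2)
  have h2 : (1 / ‖x‖ ^ 2) ^ ((n - q) / 2) = ‖x‖ ^ (q - n) := by
    rw [one_div, Real.inv_rpow (by positivity), ← Real.rpow_natCast, ← Real.rpow_mul hx.le,
      ← Real.rpow_neg hx.le]
    congr 1
    push_cast
    ring
  rw [h2] at h1
  rw [← ENNReal.ofReal_mul hΓ.le, mul_comm (Real.Gamma _), ← h1,
    ofReal_integral_eq_lintegral_ofReal]
  · refine setLIntegral_congr_fun measurableSet_Ioi fun s hs => ?_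
    rw [← ENNReal.ofReal_mul (Real.rpow_nonneg (le_of_lt hs) _)]
    ring_nf
  · by_contra hint
    rw [integral_undef hint] at h1
    have : 0 < ‖x‖ ^ (q - n) * Real.Gamma ((n - q) / 2) := by positivity
    exact this.ne h1
  · filter_upwards [ae_restrict_mem measurableSet_Ioi] with s hs
    exact mul_nonneg (Real.rpow_nonneg (le_of_lt hs) _) (Real.exp_pos _).le

/-- Tonelli applied to the Gaussian mixture; the weight in `s` is positive, so comparisons of
`gaussShell` pass to `shellMass`. -/
theorem Gamma_mul_shellMass (hK : IsCompact K) {q : ℝ} (hq : q < n) :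
    ENNReal.ofReal (Real.Gamma ((n - q) / 2)) * shellMass q K =
      ∫⁻ s in Ioi (0 : ℝ), ENNReal.ofReal (s ^ ((n - q) / 2 - 1)) * gaussShell K s := by
  rw [shellMass, ← lintegral_const_mul' _ _ ENNReal.ofReal_ne_top]
  rw [setLIntegral_congr_fun (hK.measurableSet.diff (measurableSet_unitBall n)) fun x hx =>
    (lintegral_rpow_mul_exp_norm hq (one_pos.trans (one_lt_norm_of_mem_sdiff hx))).symm,
    lintegral_lintegral_swap (by fun_prop)]
  refine lintegral_congr fun s => ?_
  rw [gaussShell, lintegral_const_mul' _ _ ENNReal.ofReal_ne_top]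

theorem gaussShell_add_ball (hB : unitBall n ⊆ K) (s : ℝ) :
    gaussShell K s + ∫⁻ x in unitBall n, ENNReal.ofReal (Real.exp (-s * ‖x‖ ^ 2)) =
      ∫⁻ x in K, ENNReal.ofReal (Real.exp (-s * ‖x‖ ^ 2)) := by
  rw [gaussShell, ← lintegral_union (measurableSet_unitBall n) disjoint_sdiff_left,
    sdiff_union_of_subset hB]

theorem lintegral_exp_unitBall_ne_top {s : ℝ} (hs : 0 ≤ s) :
    ∫⁻ x in unitBall n, ENNReal.ofReal (Real.exp (-s * ‖x‖ ^ 2)) ≠ ⊤ := by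
  refine ne_top_of_le_ne_top (isCompact_closedBall (0 : EuclideanSpace ℝ (Fin n)) 1).measure_lt_top.ne
    (le_trans (lintegral_mono (g := fun _ => 1) fun x => ?_) (setLIntegral_one _).le)
  rw [ENNReal.ofReal_le_one, Real.exp_le_one_iff]
  nlinarith [sq_nonneg ‖x‖]

theorem unitBall_subset_cube (n : ℕ) : unitBall n ⊆ cube n := by
  intro x hx i
  have h1 : ‖x‖ ≤ 1 := by simpa [unitBall] using hx
  exact (PiLp.norm_apply_le x i).trans h1

theorem norm_sq_le_of_mem_cube {x : EuclideanSpace ℝ (Fin n)} (hx : x ∈ cube n) :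
    ‖x‖ ^ 2 ≤ n := by
  rw [EuclideanSpace.norm_sq_eq]
  calc ∑ i, ‖x i‖ ^ 2 ≤ ∑ _i : Fin n, (1 : ℝ) := by
        refine Finset.sum_le_sum fun i _ => ?_
        rw [Real.norm_eq_abs]
        exact pow_le_one₀ (abs_nonneg _) (hx i)
    _ = n := by simp

theorem isSymmConvexBody_cube (n : ℕ) : IsSymmConvexBody (cube n) where
  convex := by
    have : cube n = ⋂ i, {x : EuclideanSpace ℝ (Fin n) | x i ∈ Icc (-1 : ℝ) 1} := by
      ext; simp [cube, abs_le]
    rw [this]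
    exact convex_iInter fun i => (convex_Icc (-1 : ℝ) 1).linear_preimage
      (EuclideanSpace.proj (𝕜 := ℝ) i : EuclideanSpace ℝ (Fin n) →L[ℝ] ℝ).toLinearMap
  isCompact := by
    have hcl : IsClosed (cube n) := by
      have : cube n = ⋂ i, {x : EuclideanSpace ℝ (Fin n) | |x i| ≤ 1} := by ext; simp [cube]
      rw [this]
      exact isClosed_iInter fun i => isClosed_le (by fun_prop) (by fun_prop)
    refine (isCompact_closedBall (0 : EuclideanSpace ℝ (Fin n)) √n).of_isClosed_subset hcl
      fun x hx => ?_
    rw [mem_closedBall_zero_iff]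
    exact Real.le_sqrt_of_sq_le (norm_sq_le_of_mem_cube hx)
  interior_nonempty :=
    ⟨0, interior_mono (unitBall_subset_cube n)
      (mem_interior_iff_mem_nhds.2 (Metric.closedBall_mem_nhds 0 one_pos))⟩
  neg_mem := fun x hx i => by simpa using hx i

/-- Both bodies contain the unit ball, whose finite Gaussian mass cancels. -/
theorem gaussShell_le_cube (hn : 1 ≤ n) (hK : IsSymmConvexBody K) (hJ : InJohnPosition K)
    {s : ℝ} (hs : 0 ≤ s) : gaussShell K s ≤ gaussShell (cube n) s := by
  refine (ENNReal.add_le_add_iff_right (lintegral_exp_unitBall_ne_top (n := n) hs)).1 ?_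
  rw [gaussShell_add_ball hJ.1, gaussShell_add_ball (unitBall_subset_cube n)]
  exact lintegral_exp_le_cube hn hK hJ s

theorem eventually_gaussShell_lt_cube (hJ : InJohnPosition K)
    (hvol : volume K < ENNReal.ofReal (2 ^ n)) :
    ∀ᶠ s : ℝ in 𝓝[≥] 0, gaussShell K s < gaussShell (cube n) s := by
  -- Since `‖x‖² ≤ n` on the cube, this bounds its Gaussian mass below for `s ≥ 0`, while that of
  -- `K` is at most `volume K`.
  have hc : Continuous fun s : ℝ => ENNReal.ofReal (Real.exp (-s * n)) * volume (cube n) := by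
    have : volume (cube n) ≠ ⊤ := by rw [volume_cube]; exact ENNReal.ofReal_ne_top
    refine ENNReal.continuous_mul_const this |>.comp ?_
    exact ENNReal.continuous_ofReal.comp (by fun_prop)
  have h1 : ∀ᶠ s : ℝ in 𝓝 0, volume K < ENNReal.ofReal (Real.exp (-s * n)) * volume (cube n) :=
    (hc.tendsto 0).eventually (lt_mem_nhds (by simpa [volume_cube] using hvol))
  filter_upwards [h1.filter_mono nhdsWithin_le_nhds, self_mem_nhdsWithin] with s hs hs0
  have hs0' : 0 ≤ s := hs0
  refine (ENNReal.add_lt_add_iff_right (lintegral_exp_unitBall_ne_top (n := n) hs0')).1 ?_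
  rw [gaussShell_add_ball hJ.1, gaussShell_add_ball (unitBall_subset_cube n)]
  calc ∫⁻ x in K, ENNReal.ofReal (Real.exp (-s * ‖x‖ ^ 2)) ≤ ∫⁻ x in K, 1 := by
        refine lintegral_mono fun x => ?_
        rw [ENNReal.ofReal_le_one, Real.exp_le_one_iff]
        nlinarith [sq_nonneg ‖x‖]
    _ = volume K := setLIntegral_one _
    _ < ENNReal.ofReal (Real.exp (-s * n)) * volume (cube n) := hs
    _ = ∫⁻ x in cube n, ENNReal.ofReal (Real.exp (-s * n)) := (setLIntegral_const _ _).symm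
    _ ≤ _ := by
        refine setLIntegral_mono' (isSymmConvexBody_cube n).isCompact.measurableSet fun x hx => ?_
        refine ENNReal.ofReal_le_ofReal (Real.exp_le_exp.2 ?_)
        nlinarith [norm_sq_le_of_mem_cube hx]

theorem gaussShell_zero (K : Set (EuclideanSpace ℝ (Fin n))) : gaussShell K 0 = shellMass n K := by
  simp [gaussShell, shellMass_self]

theorem shellMass_lt_cube (hn : 1 ≤ n) (hK : IsSymmConvexBody K) (hJ : InJohnPosition K)
    (hvol : volume K < ENNReal.ofReal (2 ^ n)) {q : ℝ} (hq : q ≤ n) :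
    shellMass q K < shellMass q (cube n) := by
  have hev := eventually_gaussShell_lt_cube hJ hvol
  rcases hq.lt_or_eq with hq | rfl
  · have hC := (isSymmConvexBody_cube n).isCompact
    have ha : 0 < (n - q) / 2 := by linarith
    have hΓ : ENNReal.ofReal (Real.Gamma ((n - q) / 2)) ≠ 0 := by
      rw [ne_eq, ENNReal.ofReal_eq_zero, not_le]; exact Real.Gamma_pos_of_pos ha
    rw [← ENNReal.mul_lt_mul_iff_right hΓ ENNReal.ofReal_ne_top, Gamma_mul_shellMass hK.isCompact hq,
      Gamma_mul_shellMass hC hq]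
    refine lintegral_strict_mono_of_ae_le_of_frequently_ae_lt ?_ ?_ ?_ ?_
    · exact (Measurable.mul (by fun_prop) (measurable_gaussShell _)).aemeasurable
    · rw [← Gamma_mul_shellMass hK.isCompact hq]
      exact ENNReal.mul_ne_top ENNReal.ofReal_ne_top (shellMass_lt_top hK.isCompact hq.le).ne
    · filter_upwards [ae_restrict_mem measurableSet_Ioi] with s hs
      gcongr
      exact gaussShell_le_cube hn hK hJ (le_of_lt hs)
    -- Strictness on an interval `(0, δ)`, a set of positive measure, is enough to make the mixture
    -- strict.
    · obtain ⟨δ, hδ, hδs⟩ := (mem_nhdsGE_iff_exists_Ico_subset' (zero_lt_one' ℝ)).1 hev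
      have hδ0 : (0 : ℝ) < δ := hδ
      refine fun hnot => ?_
      have h0 : volume.restrict (Ioi (0 : ℝ)) (Ioo 0 δ) = 0 := by
        refine measure_mono_null (fun s hs => ?_) hnot
        have hlt : gaussShell K s < gaussShell (cube n) s := hδs ⟨hs.1.le, hs.2⟩
        have hpos : ENNReal.ofReal (s ^ ((n - q) / 2 - 1)) ≠ 0 := by
          rw [ne_eq, ENNReal.ofReal_eq_zero, not_le]; exact Real.rpow_pos_of_pos hs.1 _
        simpa using ((ENNReal.mul_lt_mul_iff_right hpos ENNReal.ofReal_ne_top).2 hlt).ne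
      rw [Measure.restrict_apply measurableSet_Ioo,
        inter_eq_self_of_subset_left Ioo_subset_Ioi_self, Real.volume_Ioo] at h0
      simp at h0
      linarith
  · have := hev.self_of_nhdsWithin self_mem_Ici
    rwa [gaussShell_zero, gaussShell_zero] at this

theorem IsRotationOf.shellMass_eq (h : IsRotationOf K L) (q : ℝ) :
    shellMass q K = shellMass q L := by
  obtain ⟨U, -, rfl⟩ := h
  have hset : U '' L \ unitBall n = U '' (L \ unitBall n) := by
    rw [image_sdiff U.injective]
    congr 1
    simp [unitBall]
  rw [shellMass, hset, U.measurePreserving.setLIntegral_comp_emb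
    U.toMeasurableEquiv.measurableEmbedding (fun x => ENNReal.ofReal (‖x‖ ^ (q - n))) _ |>.symm]
  simp [shellMass]

theorem IsRotationOf.volume_eq (h : IsRotationOf K L) : volume K = volume L := by
  obtain ⟨U, -, rfl⟩ := h
  exact U.measurePreserving.measure_preimage_emb U.toMeasurableEquiv.measurableEmbedding _ |>.symm.trans
    (by rw [preimage_image_eq _ U.injective])

end

/-! ### Radial functions and polar coordinates -/

section

variable {n : ℕ} {K : Set (EuclideanSpace ℝ (Fin n))}

theorem smul_mem_iff_le_radialFun (hK : IsSymmConvexBody K) (hB : unitBall n ⊆ K)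
    {x : EuclideanSpace ℝ (Fin n)} (hx : ‖x‖ = 1) {r : ℝ} (hr : 0 ≤ r) :
    r • x ∈ K ↔ r ≤ radialFun K x := by
  set A := {t : ℝ | 0 ≤ t ∧ t • x ∈ K} with hA
  obtain ⟨R, hR⟩ := hK.isCompact.isBounded.subset_closedBall 0
  have hAR : A ⊆ Icc 0 R := by
    rintro t ⟨ht0, ht⟩
    have := hR ht
    rw [mem_closedBall_zero_iff, norm_smul, hx, mul_one, Real.norm_eq_abs, abs_of_nonneg ht0]
      at this
    exact ⟨ht0, this⟩
  have hcl : IsClosed A := by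
    have hc : Continuous fun t : ℝ => t • x := by fun_prop
    exact (isClosed_le continuous_const continuous_id).inter (hK.isCompact.isClosed.preimage hc)
  have hcomp : IsCompact A := isCompact_Icc.of_isClosed_subset hcl hAR
  have h0K : (0 : EuclideanSpace ℝ (Fin n)) ∈ K := hB (by simp [unitBall])
  have hmem : sSup A ∈ A := hcomp.sSup_mem ⟨0, le_rfl, by simpa using h0K⟩
  change _ ↔ r ≤ sSup A
  constructor
  · exact fun h => le_csSup hcomp.bddAbove ⟨hr, h⟩
  · intro h
    rcases hmem.1.eq_or_lt with h0 | h0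
    · rw [← h0] at h
      rw [le_antisymm h hr, zero_smul]
      exact h0K
    · have h1 : r • x = (r / sSup A) • (sSup A • x) := by
        rw [smul_smul, div_mul_cancel₀ _ h0.ne']
      rw [h1]
      exact hK.convex.smul_mem_of_zero_mem h0K hmem.2
        ⟨div_nonneg hr h0.le, div_le_one_of_le₀ h h0.le⟩

theorem one_le_radialFun (hK : IsSymmConvexBody K) (hB : unitBall n ⊆ K)
    {x : EuclideanSpace ℝ (Fin n)} (hx : ‖x‖ = 1) : 1 ≤ radialFun K x :=
  (smul_mem_iff_le_radialFun hK hB hx zero_le_one).1 (hB (by simp [unitBall, hx]))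

theorem exists_radialFun_le (hK : IsSymmConvexBody K) (hB : unitBall n ⊆ K) :
    ∃ R, 1 ≤ R ∧ ∀ x : EuclideanSpace ℝ (Fin n), ‖x‖ = 1 → radialFun K x ≤ R := by
  obtain ⟨R, hR⟩ := hK.isCompact.isBounded.subset_closedBall 0
  refine ⟨max 1 R, le_max_left _ _, fun x hx => le_max_of_le_right ?_⟩
  have h0 : 0 ≤ radialFun K x := zero_le_one.trans (one_le_radialFun hK hB hx)
  have := hR ((smul_mem_iff_le_radialFun hK hB hx h0).2 le_rfl)
  rwa [mem_closedBall_zero_iff, norm_smul, hx, mul_one, Real.norm_eq_abs, abs_of_nonneg h0]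
    at this

theorem measurable_radialFun_sphere (hK : IsSymmConvexBody K) (hB : unitBall n ⊆ K) :
    Measurable fun u : Metric.sphere (0 : EuclideanSpace ℝ (Fin n)) 1 => radialFun K u := by
  refine measurable_of_Ici fun r => ?_
  rcases le_total r 0 with hr | hr
  · convert MeasurableSet.univ
    refine eq_univ_of_forall fun u => ?_
    exact hr.trans (zero_le_one.trans (one_le_radialFun hK hB (norm_eq_of_mem_sphere u)))
  · have : (fun u : Metric.sphere (0 : EuclideanSpace ℝ (Fin n)) 1 => radialFun K u) ⁻¹' Ici r =
        (fun u : Metric.sphere (0 : EuclideanSpace ℝ (Fin n)) 1 =>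
          r • (u : EuclideanSpace ℝ (Fin n))) ⁻¹' K := by
      ext u
      exact (smul_mem_iff_le_radialFun hK hB (norm_eq_of_mem_sphere u) hr).symm
    rw [this]
    exact (by fun_prop : Continuous fun u : Metric.sphere (0 : EuclideanSpace ℝ (Fin n)) 1 =>
      r • (u : EuclideanSpace ℝ (Fin n))).measurable hK.isCompact.measurableSet

/-- `∫₁ʳ t ^ (q - 1) dt`, that is `(r ^ q - 1) / q`, or `log r` for `q = 0`. -/
noncomputable def powPrim (q r : ℝ) : ℝ := ∫ t in (1 : ℝ)..r, t ^ (q - 1)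

theorem powPrim_zero {r : ℝ} (hr : 1 ≤ r) : powPrim 0 r = Real.log r := by
  have h1 : powPrim 0 r = ∫ t in (1 : ℝ)..r, t⁻¹ := by
    rw [powPrim]
    congr 1
    ext t
    rw [zero_sub, Real.rpow_neg_one]
  rw [h1, integral_inv_of_pos one_pos (by linarith), div_one]

theorem mul_powPrim {q r : ℝ} (hq : q ≠ 0) (hr : 1 ≤ r) : q * powPrim q r = r ^ q - 1 := by
  rw [powPrim, integral_rpow (Or.inr ⟨by intro h; apply hq; linarith, ?_⟩)]
  · rw [sub_add_cancel, Real.one_rpow]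
    field_simp
  · rw [uIcc_of_le hr]
    exact fun h => by linarith [h.1]

theorem powPrim_nonneg (q : ℝ) {r : ℝ} (hr : 1 ≤ r) : 0 ≤ powPrim q r :=
  intervalIntegral.integral_nonneg hr fun t ht => Real.rpow_nonneg (by linarith [ht.1]) _

theorem intervalIntegrable_rpow_sub_one (q : ℝ) {a b : ℝ} (ha : 1 ≤ a) (hb : 1 ≤ b) :
    IntervalIntegrable (fun t : ℝ => t ^ (q - 1)) volume a b := by
  refine intervalIntegral.intervalIntegrable_rpow (Or.inr ?_)
  intro h
  have := h.1
  have : (1 : ℝ) ≤ min a b := le_min ha hb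
  linarith

theorem ofReal_powPrim (q : ℝ) {r : ℝ} (hr : 1 ≤ r) :
    ∫⁻ t in Ioc 1 r, ENNReal.ofReal (t ^ (q - 1)) = ENNReal.ofReal (powPrim q r) := by
  rw [powPrim, intervalIntegral.integral_of_le hr, ofReal_integral_eq_lintegral_ofReal]
  · exact (intervalIntegrable_rpow_sub_one q le_rfl hr).1
  · filter_upwards [ae_restrict_mem measurableSet_Ioc] with t ht
    exact Real.rpow_nonneg (by linarith [ht.1]) _

/-- Integration in polar coordinates. -/
theorem lintegral_eq_lintegral_sphere (hn : 1 ≤ n) {f : EuclideanSpace ℝ (Fin n) → ENNReal}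
    (hf : Measurable f) :
    ∫⁻ x, f x = ∫⁻ u, (∫⁻ r in Ioi (0 : ℝ), ENNReal.ofReal (r ^ (n - 1)) *
      f (r • (u : EuclideanSpace ℝ (Fin n)))) ∂(sphereMeasure n) := by
  have : Nontrivial (EuclideanSpace ℝ (Fin n)) :=
    Module.nontrivial_of_finrank_pos (R := ℝ) (by rw [finrank_euclideanSpace_fin]; omega)
  have hmp := (volume : Measure (EuclideanSpace ℝ (Fin n))).measurePreserving_homeomorphUnitSphereProd
  rw [finrank_euclideanSpace_fin] at hmp
  have h1 := hmp.lintegral_comp_emb (Homeomorph.measurableEmbedding _)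
    fun p => f ((p.2 : ℝ) • (p.1 : EuclideanSpace ℝ (Fin n)))
  have hG : Measurable fun p : Metric.sphere (0 : EuclideanSpace ℝ (Fin n)) 1 × Ioi (0 : ℝ) =>
      f ((p.2 : ℝ) • (p.1 : EuclideanSpace ℝ (Fin n))) := hf.comp (by fun_prop)
  rw [lintegral_prod _ hG.aemeasurable] at h1
  have h2 : ∫⁻ x, f x = ∫⁻ x : ({0}ᶜ : Set (EuclideanSpace ℝ (Fin n))), f (x : EuclideanSpace ℝ (Fin n))
      ∂(volume.comap Subtype.val) := by
    rw [lintegral_subtype_comap (measurableSet_singleton _).compl, restrict_compl_singleton]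
  rw [h2]
  convert h1 using 1
  · refine lintegral_congr fun x => ?_
    have hx : ‖(x : EuclideanSpace ℝ (Fin n))‖ ≠ 0 := norm_ne_zero_iff.2 x.2
    simp [smul_smul, mul_inv_cancel₀ hx]
  · refine lintegral_congr fun u => ?_
    have hd : Measurable fun r : Ioi (0 : ℝ) => ENNReal.ofReal ((r : ℝ) ^ (n - 1)) := by fun_prop
    have hfu : Measurable fun r : Ioi (0 : ℝ) => f ((r : ℝ) • (u : EuclideanSpace ℝ (Fin n))) :=
      hf.comp (by fun_prop)
    rw [Measure.volumeIoiPow]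
    refine Eq.trans ?_ (lintegral_withDensity_eq_lintegral_mul _ hd hfu).symm
    exact (lintegral_subtype_comap measurableSet_Ioi fun r : ℝ => ENNReal.ofReal (r ^ (n - 1)) *
      f (r • (u : EuclideanSpace ℝ (Fin n)))).symm

/-- Along the ray through `u` the shell is `1 < r ≤ ρ_K(u)`, and the polar Jacobian `r ^ (n - 1)`
turns `r ^ (q - n)` into `r ^ (q - 1)`. -/
theorem shellMass_eq_lintegral_sphere (hn : 1 ≤ n) (hK : IsSymmConvexBody K)
    (hB : unitBall n ⊆ K) (q : ℝ) :
    shellMass q K = ∫⁻ u, ENNReal.ofReal (powPrim q (radialFun K (u : EuclideanSpace ℝ (Fin n))))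
      ∂(sphereMeasure n) := by
  have hmeas := hK.isCompact.measurableSet.diff (measurableSet_unitBall n)
  rw [shellMass, ← lintegral_indicator hmeas,
    lintegral_eq_lintegral_sphere hn (Measurable.indicator (by fun_prop) hmeas)]
  refine lintegral_congr fun u => ?_
  have hu : ‖(u : EuclideanSpace ℝ (Fin n))‖ = 1 := norm_eq_of_mem_sphere u
  set ρ := radialFun K (u : EuclideanSpace ℝ (Fin n))
  rw [← ofReal_powPrim q (one_le_radialFun hK hB hu),
    ← lintegral_indicator measurableSet_Ioi, ← lintegral_indicator measurableSet_Ioc]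
  refine lintegral_congr fun r => ?_
  by_cases hr : r ∈ Ioc 1 ρ
  · have hr0 : 0 < r := one_pos.trans hr.1
    have hnorm : ‖r • (u : EuclideanSpace ℝ (Fin n))‖ = r := by
      rw [norm_smul, hu, mul_one, Real.norm_eq_abs, abs_of_pos hr0]
    have hmem : r • (u : EuclideanSpace ℝ (Fin n)) ∈ K \ unitBall n :=
      ⟨(smul_mem_iff_le_radialFun hK hB hu hr0.le).2 hr.2, by simpa [unitBall, hnorm] using hr.1⟩
    rw [indicator_of_mem hr, indicator_of_mem (show r ∈ Ioi (0 : ℝ) from hr0),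
      indicator_of_mem hmem, hnorm, ← ENNReal.ofReal_mul (by positivity), ← Real.rpow_natCast,
      ← Real.rpow_add hr0, Nat.cast_sub hn]
    congr 2
    push_cast
    ring
  · rw [indicator_of_notMem hr]
    by_cases hr0 : r ∈ Ioi (0 : ℝ)
    · have hr0' : 0 < r := hr0
      rw [indicator_of_mem hr0, indicator_of_notMem, mul_zero]
      rintro ⟨h1, h2⟩
      refine hr ⟨?_, (smul_mem_iff_le_radialFun hK hB hu hr0'.le).1 h1⟩
      simpa [unitBall, norm_smul, hu, abs_of_pos hr0'] using h2
    · rw [indicator_of_notMem hr0]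

end

/-! ### Dual quermassintegrals as increasing functions of the shell mass -/

section

variable {n : ℕ} {K L : Set (EuclideanSpace ℝ (Fin n))}

/-- The integral of `powPrim q ∘ ρ_K` over the sphere. -/
noncomputable def radialPrim (q : ℝ) (K : Set (EuclideanSpace ℝ (Fin n))) : ℝ :=
  ∫ u, powPrim q (radialFun K (u : EuclideanSpace ℝ (Fin n))) ∂(sphereMeasure n)

instance (n : ℕ) : IsFiniteMeasure (sphereMeasure n) := by
  unfold sphereMeasure
  infer_instance

theorem omega_pos (n : ℕ) : 0 < omega n :=
  ENNReal.toReal_pos (Metric.measure_closedBall_pos _ _ one_pos).ne'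
    (isCompact_closedBall _ _).measure_lt_top.ne

theorem sphereMeasure_real_univ (n : ℕ) : (sphereMeasure n).real univ = n * omega n := by
  rw [sphereMeasure, Measure.toSphere_real_apply_univ, finrank_euclideanSpace_fin, omega, unitBall,
    measureReal_def, measureReal_def, Measure.addHaar_unitClosedBall_eq_addHaar_unitBall]

theorem integrable_comp_radialFun (hK : IsSymmConvexBody K) (hB : unitBall n ⊆ K) {f : ℝ → ℝ}
    (hf : MonotoneOn f (Ici 1) ∨ AntitoneOn f (Ici 1)) (hfm : Measurable f) :
    Integrable (fun u : Metric.sphere (0 : EuclideanSpace ℝ (Fin n)) 1 => f (radialFun K u))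
      (sphereMeasure n) := by
  obtain ⟨R, hR1, hR⟩ := exists_radialFun_le hK hB
  refine Integrable.of_bound (hfm.comp (measurable_radialFun_sphere hK hB)).aestronglyMeasurable
    (max |f 1| |f R|) (Eventually.of_forall fun u => ?_)
  have hu := norm_eq_of_mem_sphere u
  have h1 := one_le_radialFun hK hB hu
  have h2 := hR u hu
  rcases hf with hf | hf
  · have e1 := hf (mem_Ici.2 le_rfl) (mem_Ici.2 h1) h1
    have e2 := hf (mem_Ici.2 h1) (mem_Ici.2 hR1) h2
    exact abs_le_max_abs_abs e1 e2
  · have e1 := hf (mem_Ici.2 le_rfl) (mem_Ici.2 h1) h1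
    have e2 := hf (mem_Ici.2 h1) (mem_Ici.2 hR1) h2
    rw [max_comm]
    exact abs_le_max_abs_abs e2 e1

theorem integrable_radialFun_rpow (hK : IsSymmConvexBody K) (hB : unitBall n ⊆ K) (q : ℝ) :
    Integrable (fun u : Metric.sphere (0 : EuclideanSpace ℝ (Fin n)) 1 => radialFun K u ^ q)
      (sphereMeasure n) := by
  refine integrable_comp_radialFun hK hB (f := fun r => r ^ q) ?_ (by fun_prop)
  rcases le_total 0 q with hq | hq
  · exact Or.inl fun a ha b _ hab => Real.rpow_le_rpow (zero_le_one.trans ha) hab hq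
  · exact Or.inr fun a ha b _ hab =>
      Real.rpow_le_rpow_of_nonpos (one_pos.trans_le ha) hab hq

theorem integrable_powPrim (hK : IsSymmConvexBody K) (hB : unitBall n ⊆ K) (q : ℝ) :
    Integrable (fun u : Metric.sphere (0 : EuclideanSpace ℝ (Fin n)) 1 =>
      powPrim q (radialFun K u)) (sphereMeasure n) := by
  have h1 : ∀ u : Metric.sphere (0 : EuclideanSpace ℝ (Fin n)) 1, 1 ≤ radialFun K u :=
    fun u => one_le_radialFun hK hB (norm_eq_of_mem_sphere u)
  rcases eq_or_ne q 0 with rfl | hq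
  · simp_rw [powPrim_zero (h1 _)]
    exact integrable_comp_radialFun hK hB
      (Or.inl fun a ha b _ hab => Real.log_le_log (one_pos.trans_le ha) hab) Real.measurable_log
  · have : (fun u : Metric.sphere (0 : EuclideanSpace ℝ (Fin n)) 1 =>
        powPrim q (radialFun K u)) =
        fun u : Metric.sphere (0 : EuclideanSpace ℝ (Fin n)) 1 => (radialFun K u ^ q - 1) / q := by
      ext u
      rw [← mul_powPrim hq (h1 u)]
      field_simp
    rw [this]
    exact ((integrable_radialFun_rpow hK hB q).sub (integrable_const 1)).div_const q

theorem radialPrim_nonneg (hK : IsSymmConvexBody K) (hB : unitBall n ⊆ K) (q : ℝ) :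
    0 ≤ radialPrim q K :=
  integral_nonneg fun u => powPrim_nonneg q (one_le_radialFun hK hB (norm_eq_of_mem_sphere u))

theorem shellMass_eq_ofReal (hn : 1 ≤ n) (hK : IsSymmConvexBody K) (hB : unitBall n ⊆ K) (q : ℝ) :
    shellMass q K = ENNReal.ofReal (radialPrim q K) := by
  rw [shellMass_eq_lintegral_sphere hn hK hB, radialPrim,
    ofReal_integral_eq_lintegral_ofReal (integrable_powPrim hK hB q)]
  exact Eventually.of_forall fun u =>
    powPrim_nonneg q (one_le_radialFun hK hB (norm_eq_of_mem_sphere u))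

theorem integral_radialFun_rpow (hK : IsSymmConvexBody K) (hB : unitBall n ⊆ K)
    {q : ℝ} (hq : q ≠ 0) :
    ∫ u, radialFun K (u : EuclideanSpace ℝ (Fin n)) ^ q ∂(sphereMeasure n) =
      n * omega n + q * radialPrim q K := by
  have h1 : ∀ u : Metric.sphere (0 : EuclideanSpace ℝ (Fin n)) 1,
      radialFun K u ^ q = 1 + q * powPrim q (radialFun K u) := fun u => by
    rw [mul_powPrim hq (one_le_radialFun hK hB (norm_eq_of_mem_sphere u))]
    ring
  simp_rw [h1]
  rw [integral_add (integrable_const _) ((integrable_powPrim hK hB q).const_mul q),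
    integral_const, sphereMeasure_real_univ n, integral_const_mul, smul_eq_mul, mul_one, radialPrim]

theorem integral_radialFun_rpow_pos (hn : 1 ≤ n) (hK : IsSymmConvexBody K) (hB : unitBall n ⊆ K)
    (q : ℝ) : 0 < ∫ u, radialFun K (u : EuclideanSpace ℝ (Fin n)) ^ q ∂(sphereMeasure n) := by
  have hpos : ∀ u : Metric.sphere (0 : EuclideanSpace ℝ (Fin n)) 1, 0 < radialFun K u ^ q :=
    fun u => Real.rpow_pos_of_pos
      (one_pos.trans_le (one_le_radialFun hK hB (norm_eq_of_mem_sphere u))) q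
  rw [integral_pos_iff_support_of_nonneg (fun u => (hpos u).le) (integrable_radialFun_rpow hK hB q)]
  have hsupp : Function.support (fun u : Metric.sphere (0 : EuclideanSpace ℝ (Fin n)) 1 =>
      radialFun K u ^ q) = univ := eq_univ_of_forall fun u => (hpos u).ne'
  rw [hsupp, pos_iff_ne_zero]
  intro h0
  have h1 := sphereMeasure_real_univ n
  rw [measureReal_def, h0, ENNReal.toReal_zero] at h1
  have := omega_pos n
  have : 0 < (n : ℝ) * omega n := by positivity
  linarith

theorem dualQuermass_div_omega (hn : 1 ≤ n) (hK : IsSymmConvexBody K) (hB : unitBall n ⊆ K)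
    {q : ℝ} (hq : q ≠ 0) :
    dualQuermass q K / omega n = 1 + q * radialPrim q K / (n * omega n) := by
  have := omega_pos n
  rw [dualQuermass, integral_radialFun_rpow hK hB hq]
  field_simp

theorem dualQuermass_div_omega_pos (hn : 1 ≤ n) (hK : IsSymmConvexBody K) (hB : unitBall n ⊆ K)
    (q : ℝ) : 0 < dualQuermass q K / omega n := by
  have := omega_pos n
  have := integral_radialFun_rpow_pos hn hK hB q
  rw [dualQuermass]
  positivity

theorem dualEntropy_eq_radialPrim (hK : IsSymmConvexBody K) (hB : unitBall n ⊆ K) :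
    dualEntropy K = radialPrim 0 K :=
  integral_congr_ae (Eventually.of_forall fun u =>
    (powPrim_zero (one_le_radialFun hK hB (norm_eq_of_mem_sphere u))).symm)

theorem normDualQuermass_lt_of_radialPrim_lt (hn : 1 ≤ n) (hK : IsSymmConvexBody K)
    (hBK : unitBall n ⊆ K) (hL : IsSymmConvexBody L) (hBL : unitBall n ⊆ L) {q : ℝ}
    (h : radialPrim q K < radialPrim q L) : normDualQuermass q K < normDualQuermass q L := by
  have hω := omega_pos n
  have hnω : 0 < (n : ℝ) * omega n := by positivity
  rcases eq_or_ne q 0 with rfl | hq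
  · rw [normDualQuermass, normDualQuermass, if_pos rfl, if_pos rfl,
      dualEntropy_eq_radialPrim hK hBK, dualEntropy_eq_radialPrim hL hBL, Real.exp_lt_exp]
    exact mul_lt_mul_of_pos_left h (by positivity)
  · rw [normDualQuermass, normDualQuermass, if_neg hq, if_neg hq]
    have hKpos := dualQuermass_div_omega_pos hn hK hBK q
    have hLpos := dualQuermass_div_omega_pos hn hL hBL q
    rcases hq.lt_or_gt with hq0 | hq0
    -- For `q < 0` the order is reversed twice: by the factor `q` and by the exponent `1 / q`.
    · refine Real.rpow_lt_rpow_of_neg hLpos ?_ (one_div_neg.2 hq0)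
      rw [dualQuermass_div_omega hn hK hBK hq, dualQuermass_div_omega hn hL hBL hq]
      have := mul_lt_mul_of_neg_left h hq0
      gcongr
    · refine Real.rpow_lt_rpow hKpos.le ?_ (one_div_pos.2 hq0)
      rw [dualQuermass_div_omega hn hK hBK hq, dualQuermass_div_omega hn hL hBL hq]
      gcongr

theorem normDualQuermass_eq_of_radialPrim_eq (hn : 1 ≤ n) (hK : IsSymmConvexBody K)
    (hBK : unitBall n ⊆ K) (hL : IsSymmConvexBody L) (hBL : unitBall n ⊆ L) {q : ℝ}
    (h : radialPrim q K = radialPrim q L) : normDualQuermass q K = normDualQuermass q L := by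
  rcases eq_or_ne q 0 with rfl | hq
  · rw [normDualQuermass, normDualQuermass, if_pos rfl, if_pos rfl,
      dualEntropy_eq_radialPrim hK hBK, dualEntropy_eq_radialPrim hL hBL, h]
  · rw [normDualQuermass, normDualQuermass, if_neg hq, if_neg hq,
      dualQuermass_div_omega hn hK hBK hq, dualQuermass_div_omega hn hL hBL hq, h]

theorem dualQuermass_natCast (hn : 1 ≤ n) (hK : IsSymmConvexBody K) (hB : unitBall n ⊆ K) :
    dualQuermass (n : ℝ) K = volume.real K := by
  have hn0 : (n : ℝ) ≠ 0 := by positivity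
  have h1 : radialPrim n K = volume.real (K \ unitBall n) := by
    rw [measureReal_def, ← shellMass_self, shellMass_eq_ofReal hn hK hB,
      ENNReal.toReal_ofReal (radialPrim_nonneg hK hB _)]
  have h2 : volume.real (K \ unitBall n) = volume.real K - omega n :=
    measureReal_sdiff hB (measurableSet_unitBall n) hK.isCompact.measure_lt_top.ne
  rw [dualQuermass, integral_radialFun_rpow hK hB hn0, h1, h2]
  field_simp
  ring

end

end DualQuermass

theorem mainTheorem2 (n : ℕ) (hn : 1 ≤ n) (K : Set (EuclideanSpace ℝ (Fin n)))
    (hK : DualQuermass.IsSymmConvexBody K) (hJ : DualQuermass.InJohnPosition K) :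
    (∀ q : ℝ, q ≤ n →
      DualQuermass.normDualQuermass q K ≤ DualQuermass.normDualQuermass q (DualQuermass.cube n) ∧
      (DualQuermass.normDualQuermass q K = DualQuermass.normDualQuermass q (DualQuermass.cube n) ↔
        DualQuermass.IsRotationOf K (DualQuermass.cube n))) ∧
    (DualQuermass.normDualQuermass (n : ℝ) K =
        (volume.real K / DualQuermass.omega n) ^ (1 / (n : ℝ)) ∧
      volume.real K / DualQuermass.omega n ≤
        volume.real (DualQuermass.cube n) / DualQuermass.omega n) := by
  open DualQuermass in
  have hC := isSymmConvexBody_cube n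
  have hBC := unitBall_subset_cube n
  have hvolC : volume (cube n) ≠ ⊤ := hC.isCompact.measure_lt_top.ne
  refine ⟨fun q hq => ?_, ?_, ?_⟩
  -- The case split does not depend on `q`: smaller volume gives strict inequality for every `q ≤
  -- n`, and otherwise `K` is a rotated cube.
  · by_cases hvol : volume K < ENNReal.ofReal (2 ^ n)
    · have hlt : normDualQuermass q K < normDualQuermass q (cube n) := by
        refine normDualQuermass_lt_of_radialPrim_lt hn hK hJ.1 hC hBC ?_
        have h1 := shellMass_lt_cube hn hK hJ hvol hq
        rw [shellMass_eq_ofReal hn hK hJ.1, shellMass_eq_ofReal hn hC hBC] at h1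
        exact ENNReal.ofReal_lt_ofReal_iff_of_nonneg (radialPrim_nonneg hK hJ.1 q) |>.1 h1
      refine ⟨hlt.le, fun h => absurd h hlt.ne, fun h => ?_⟩
      rw [h.volume_eq, volume_cube] at hvol
      exact absurd hvol (lt_irrefl _)
    · have hrot := isRotationOf_cube_of_volume_le hn hK hJ (not_lt.1 hvol)
      have heq : normDualQuermass q K = normDualQuermass q (cube n) := by
        refine normDualQuermass_eq_of_radialPrim_eq hn hK hJ.1 hC hBC ?_
        have h1 := hrot.shellMass_eq q
        rw [shellMass_eq_ofReal hn hK hJ.1, shellMass_eq_ofReal hn hC hBC] at h1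
        exact (ENNReal.ofReal_eq_ofReal_iff (radialPrim_nonneg hK hJ.1 q)
          (radialPrim_nonneg hC hBC q)).1 h1
      exact ⟨heq.le, fun _ => hrot, fun _ => heq⟩
  · rw [normDualQuermass, if_neg (by positivity), dualQuermass_natCast hn hK hJ.1]
  · have h1 : volume K ≤ volume (cube n) := by
      simpa using lintegral_exp_le_cube hn hK hJ 0
    have h2 : volume.real K ≤ volume.real (cube n) := ENNReal.toReal_mono hvolC h1
    exact div_le_div_of_nonneg_right h2 (omega_pos n).le
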